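/- **Setting.** Let $\rho$ be an $n$-qubit state, $O$ a Hermitian operator, $V_1,\dots,V_m$ unitaries and $H_1,\dots,H_m$ Hermitian operators on $n$ qubits. For $\theta\in\mathbb R^m$ put $$U(\theta)=V_1e^{-i\theta_1H_1}\,V_2e^{-i\theta_2H_2}\cdots V_me^{-i\theta_mH_m},\qquad \mathcal L(\theta)=\mathrm{Tr}[U(\theta)\rho U(\theta)^\dagger O]$$ (each rotation has its own parameter; the gate with label $m$ acts first on the state). For $\phi\in\mathbb R^m$ and $r>0$ let $\mathcal D(\phi,r)$ be the uniform distribution on $\prod_{i}[\phi_i-r,\phi_i+r]$. With $\|\cdot\|$ the operator norm, define $$c_l(\phi)=\left|\partial_{\theta_l}^2\mathcal L(\phi)\right|,\qquad \omega_l=\lambda_{\max}(H_l)-\lambda_{\min}(H_l),$$ $$\omega^{\rm eff}_\mu(\phi)=\left\|\partial_{\theta_\mu}^2[U(\theta)^\dagger OU(\theta)]_{\theta=\phi}\right\|^{1/2},\qquad \widetilde\omega^{\rm eff}_{l,\mu}(\phi)=\left\|\partial_{\theta_\mu}^2\partial_{\theta_l}^2[U(\theta)^\dagger OU(\theta)]_{\theta=\phi}\right\|^{1/2},$$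 $$F_l(\phi)=4\omega_l^2\sum_{\mu<l}\omega^{\rm eff}_\mu(\phi)^2+\sum_{\mu>l}\widetilde\omega^{\rm eff}_{l,\mu}(\phi)^2,\qquad \alpha_l(\phi)=\tfrac16F_l(\phi),$$ $$\beta_1=\tfrac23\,\omega_1^2\,\omega^{\rm eff}_1(\phi)^4,\qquad \beta_l=\tfrac{32}3\,\omega_l^6\,\|O\|^2\quad(l>1),$$ and, for a nonempty set $\Lambda\subseteq\{1,\dots,m\}$, $$r_{\rm patch}^2=\min_{l\in\Lambda}\frac{9\,c_l(\phi)^2}{8\,c_l(\phi)F_l(\phi)+24\,\beta_l}$$ (a quotient $0/0$ is read as $0$). **Theorem.** (i) For all $\phi$, all nonempty $\Lambda$ and all $r>0$ with $r^2\le r_{\rm patch}^2$, $$\mathrm{Var}_{\theta\sim\mathcal D(\phi,r)}[\mathcal L(\theta)]\ \ge\ \sum_{l\in\Lambda}\frac{r^4}{45}\Big[\big(c_l(\phi)-\alpha_l(\phi)r^2\big)^2-\beta_lr^2\Big]\qquad\text{and}\qquad \mathrm{Var}_{\theta\sim\mathcal D(\phi,r)}[\mathcal L(\theta)]\ \ge\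 \frac1{72}\Big(\sum_{l\in\Lambda}c_l(\phi)^2\Big)r^4 ,$$ and the second bound holds in particular for $r=r_{\rm patch}$ if $r_{\rm patch}>0$. (ii) For all exponents $a,b,c\in\mathbb N$ there is $k_0\in\mathbb N$ such that for every $k_1\in\mathbb N$ there is $k_2\in\mathbb N$ with the following property. Consider any family of problems as above indexed by $n\in\mathbb N$, with $n$ qubits, $m=m(n)$ parameters, points $\phi=\phi(n)$ and labels $q=q(n)\in\{1,\dots,m(n)\}$, such that $\|O\|\in\mathcal O(n^a)$, $\|H_k\|\in\mathcal O(n^b)$ uniformly in $k$, and $c_q(\phi)\in\Omega(n^{-c})$. If $p:\mathbb N\to\mathbb R$ is polynomially bounded and grows fast enough, namely $|p(n)|\in\Omega(n^{k_0})\cap\mathcal O(n^{k_1})$, and $r(n)>0$ satisfies $r\in\Theta\big(1/(|p(n)|\sqrt m)\big)$, then $$\mathrm{Var}_{\theta\sim\mathcal D(\phi,r)}[\mathcal L(\theta)]\in\Omega\!\left(\frac1{n^{k_2}\,m^2}\right).$$ -/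

import Mathlib

open MeasureTheory ProbabilityTheory Filter Asymptotics
open scoped Matrix ComplexOrder Matrix.Norms.L2Operator

noncomputable section

/-- Computational basis labels of `n` qubits. -/
abbrev Qubits (n : ℕ) : Type := Fin n → Fin 2

/-- Operators on the `n`-qubit space `(ℂ²)^{⊗ n}`. Their norm `‖·‖` is the spectral (operator) norm. -/
abbrev QOp (n : ℕ) : Type := Matrix (Qubits n) (Qubits n) ℂ

/-- A variational problem on `n` qubits with `m` independent parameters: an input state, an
observable, fixed unitary gates `V₁, …, V_m` and Hermitian generators `H₁, …, H_m`. The index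
`l : Fin m` stands for the label `l + 1 ∈ {1, …, m}`. -/
structure VarProblem (n m : ℕ) where
  state : QOp n
  state_posSemidef : state.PosSemidef
  state_trace : state.trace = 1
  obs : QOp n
  obs_isHermitian : obs.IsHermitian
  fixedGate : Fin m → QOp n
  fixedGate_unitary : ∀ l, fixedGate l ∈ Matrix.unitaryGroup (Qubits n) ℂ
  gen : Fin m → QOp n
  gen_isHermitian : ∀ l, (gen l).IsHermitian

/-- Second partial derivative of `f` with respect to the `l`-th coordinate. -/
def partialSq {m : ℕ} {E : Type*} [NormedAddCommGroup E] [NormedSpace ℝ E]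
    (l : Fin m) (f : (Fin m → ℝ) → E) (φ : Fin m → ℝ) : E :=
  iteratedDeriv 2 (fun t : ℝ => f (Function.update φ l t)) (φ l)

/-- The hypercube of half-width `r` centred at `φ`. -/
def cube {m : ℕ} (φ : Fin m → ℝ) (r : ℝ) : Set (Fin m → ℝ) :=
  {θ | ∀ i, θ i ∈ Set.Icc (φ i - r) (φ i + r)}

/-- The uniform distribution on the hypercube: normalized Lebesgue measure. -/
def cubeUniform {m : ℕ} (φ : Fin m → ℝ) (r : ℝ) : Measure (Fin m → ℝ) :=
  ProbabilityTheory.cond volume (cube φ r)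

/-- The maximal frequency `λ_max(H) - λ_min(H)` of a Hermitian operator. -/
def maxFreqOf {n : ℕ} {H : QOp n} (hH : H.IsHermitian) : ℝ :=
  (⨆ i, hH.eigenvalues i) - ⨅ i, hH.eigenvalues i

namespace VarProblem

variable {n m : ℕ} (P : VarProblem n m)

/-- The rotated gate `V_l e^{-i t H_l}`. -/
def gate (l : Fin m) (t : ℝ) : QOp n :=
  P.fixedGate l * NormedSpace.exp ((-(Complex.I * (t : ℂ))) • P.gen l)

/-- The circuit `U(θ) = V₁ e^{-iθ₁H₁} V₂ e^{-iθ₂H₂} ⋯ V_m e^{-iθ_mH_m}`; the last gate acts first on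
the state, the first one is closest to the observable. -/
def circuit (θ : Fin m → ℝ) : QOp n :=
  (List.ofFn fun l => P.gate l (θ l)).prod

/-- The loss `Tr[U(θ) ρ U(θ)† O]` (a real number, as `ρ` and `O` are Hermitian). -/
def loss (θ : Fin m → ℝ) : ℝ :=
  (P.circuit θ * P.state * (P.circuit θ)ᴴ * P.obs).trace.re

/-- The back-propagated observable `U(θ)† O U(θ)`. -/
def heisenberg (θ : Fin m → ℝ) : QOp n :=
  (P.circuit θ)ᴴ * P.obs * P.circuit θ

/-- The variance of the loss for `θ` uniform on the hypercube of half-width `r` around `φ`. -/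
def lossVar (φ : Fin m → ℝ) (r : ℝ) : ℝ :=
  ProbabilityTheory.variance P.loss (cubeUniform φ r)

/-- The curvature `c_l(φ)`. -/
def curv (φ : Fin m → ℝ) (l : Fin m) : ℝ :=
  |partialSq l P.loss φ|

/-- The maximal frequency of the `l`-th generator. -/
def maxFreq (l : Fin m) : ℝ :=
  maxFreqOf (P.gen_isHermitian l)

/-- The effective frequency of the parameter `μ` at `φ`. -/
def effFreq (φ : Fin m → ℝ) (μ : Fin m) : ℝ :=
  Real.sqrt ‖partialSq μ P.heisenberg φ‖

/-- The effective frequency of the pair of parameters `l`, `μ` at `φ`. -/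
def effFreq₂ (φ : Fin m → ℝ) (l μ : Fin m) : ℝ :=
  Real.sqrt ‖partialSq μ (partialSq l P.heisenberg) φ‖

/-- `4 ω_l² ∑_{μ<l} (ω_μ^eff)² + ∑_{μ>l} (ω_{l,μ}^eff)²`. -/
def freqSum (φ : Fin m → ℝ) (l : Fin m) : ℝ :=
  4 * P.maxFreq l ^ 2 * ∑ μ ∈ Finset.Iio l, P.effFreq φ μ ^ 2
    + ∑ μ ∈ Finset.Ioi l, P.effFreq₂ φ l μ ^ 2

/-- The coefficient `β_l`, with a separate value for the first label. -/
def beta (φ : Fin m → ℝ) (l : Fin m) : ℝ :=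
  if (l : ℕ) = 0 then 2 * P.maxFreq l ^ 2 * P.effFreq φ l ^ 4 / 3
  else 32 * P.maxFreq l ^ 6 * ‖P.obs‖ ^ 2 / 3

/-- The squared patch radius of the single parameter `l` (equal to `0` when `c_l(φ) = 0`). -/
def rPatchSqAt (φ : Fin m → ℝ) (l : Fin m) : ℝ :=
  9 * P.curv φ l ^ 2 / (8 * P.curv φ l * P.freqSum φ l + 24 * P.beta φ l)

/-- The squared patch radius of a nonempty set `Λ` of parameters. -/
def rPatchSq (φ : Fin m → ℝ) (Λ : Finset (Fin m)) (hΛ : Λ.Nonempty) : ℝ :=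
  Λ.inf' hΛ (P.rPatchSqAt φ)

/-- The patch radius of a nonempty set `Λ` of parameters. -/
def rPatch (φ : Fin m → ℝ) (Λ : Finset (Fin m)) (hΛ : Λ.Nonempty) : ℝ :=
  Real.sqrt (P.rPatchSq φ Λ hΛ)

end VarProblem

end

/-! Under the product measure the centred quadratics $(\theta_l-\phi_l)^2-r^2/3$ have mean zero, are
pairwise orthogonal and have squared norm $4r^4/45$. Bessel's inequality
(`sum_sq_integral_mul_centredSq_le_variance`) therefore bounds the variance below by the sum of the
squared overlaps of the loss with them, divided by that norm. Integrating over $\theta_l$ first,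
Taylor expansion gives the overlap as $\frac{2r^4}{45}I_l$ up to a fourth-derivative error, where
$I_l$ is the mean over the cube of $\partial_l^2\mathcal L$ with $\theta_l$ reset to $\phi_l$.

To compare $I_l$ with $\partial_l^2\mathcal L(\phi)$ (`abs_integral_lossJet_sub_le`), coordinates
are frozen at $\phi$ one by one, starting next to the observable; each costs $r^2/6$ times a bound
on $\partial_\mu^2\partial_l^2\mathcal L$. Derivatives of $U^\dagger OU$ insert commutators with
generators. Gates beyond the last differentiated one only conjugate by unitaries, and the rotation
of that gate commutes with its own generator, so the operator norm depends only on earlier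
parameters (`norm_jet_congr`). Those are already frozen, which is why frequencies at $\phi$ alone
suffice in $F_l$.

The Taylor error is absorbed in $\beta_l$ (`sq_overlap_lower_bound`). Inside the patch at least
$5c_l^2/8$ survives, and $\frac58\cdot\frac1{45}=\frac1{72}$. For the asymptotics,
$\omega_l\le2\|H_l\|$ bounds the denominator of the patch radius by a constant times $m\,n^{6b+2a}$,
so $r\sim1/(|p|\sqrt m)$ eventually lies in the patch. -/

/-! ### Taylor estimates on the line -/

/-- A chain of derivatives whose `k`-th term is bounded by `M` satisfies the Taylor bound to the
right of `0`. -/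
theorem abs_sub_taylor_le_right {M : ℝ} : ∀ (k : ℕ) (u : ℕ → ℝ → ℝ),
    (∀ i < k, ∀ t, HasDerivAt (u i) (u (i + 1) t) t) → (∀ t, |u k t| ≤ M) → ∀ t, 0 ≤ t →
    |u 0 t - ∑ i ∈ Finset.range k, u i 0 * t ^ i / (i.factorial : ℝ)|
      ≤ M * t ^ k / (k.factorial : ℝ) := by
  intro k
  induction k with
  | zero => intro u _ hM t _; simpa using hM t
  | succ k ih =>
    intro u hu hM t ht
    have hd : ∀ s, HasDerivAt
        (fun s => u 0 s - ∑ i ∈ Finset.range (k + 1), u i 0 * s ^ i / (i.factorial : ℝ))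
        (u 1 s - ∑ i ∈ Finset.range k, u (i + 1) 0 * s ^ i / (i.factorial : ℝ)) s := by
      intro s
      refine (hu 0 (by omega) s).sub ?_
      simp only [Finset.sum_range_succ']
      have h1 : HasDerivAt
          (fun s : ℝ => ∑ i ∈ Finset.range k, u (i + 1) 0 * s ^ (i + 1) / ((i + 1).factorial : ℝ))
          (∑ i ∈ Finset.range k, u (i + 1) 0 * s ^ i / (i.factorial : ℝ)) s := by
        refine HasDerivAt.fun_sum fun i _ => ?_
        have h2 := ((hasDerivAt_pow (i + 1) s).const_mul (u (i + 1) 0)).div_const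
          ((i + 1).factorial : ℝ)
        refine h2.congr_deriv ?_
        have : (i.factorial : ℝ) ≠ 0 := by positivity
        rw [Nat.factorial_succ]
        push_cast
        have : (i : ℝ) + 1 ≠ 0 := by positivity
        field_simp
      simpa using h1.add_const (u 0 0)
    have hb : ∀ s, HasDerivAt (fun s : ℝ => M * s ^ (k + 1) / ((k + 1).factorial : ℝ))
        (M * s ^ k / (k.factorial : ℝ)) s := by
      intro s
      have h2 := ((hasDerivAt_pow (k + 1) s).const_mul M).div_const ((k + 1).factorial : ℝ)
      refine h2.congr_deriv ?_
      have : (k.factorial : ℝ) ≠ 0 := by positivity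
      rw [Nat.factorial_succ]
      push_cast
      have : (k : ℝ) + 1 ≠ 0 := by positivity
      field_simp
    -- The induction hypothesis for the shifted chain bounds the derivative of the remainder; the
    -- comparison principle integrates that bound.
    have key := image_norm_le_of_norm_deriv_right_le_deriv_boundary (a := 0) (b := t)
      (fun s _ => (hd s).continuousAt.continuousWithinAt)
      (fun s _ => (hd s).hasDerivWithinAt)
      (B := fun s : ℝ => M * s ^ (k + 1) / ((k + 1).factorial : ℝ))
      (B' := fun s : ℝ => M * s ^ k / (k.factorial : ℝ))
      (by simp [Finset.sum_range_succ']) hb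
      (fun s hs => by
        have := ih (fun i => u (i + 1)) (fun i hi => hu (i + 1) (by omega)) hM s hs.1
        simpa [Real.norm_eq_abs] using this)
    simpa [Real.norm_eq_abs] using key (Set.right_mem_Icc.2 ht)

/-- Two-sided Taylor bound for a chain of derivatives. -/
theorem abs_sub_taylor_le {M : ℝ} (k : ℕ) (u : ℕ → ℝ → ℝ)
    (hu : ∀ i < k, ∀ t, HasDerivAt (u i) (u (i + 1) t) t) (hM : ∀ t, |u k t| ≤ M) (x t : ℝ) :
    |u 0 t - ∑ i ∈ Finset.range k, u i x * (t - x) ^ i / (i.factorial : ℝ)|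
      ≤ M * |t - x| ^ k / (k.factorial : ℝ) := by
  -- Reflection about `x` by the sign `ε` reduces to the right-sided bound; the chain rule turns `u
  -- i` into `ε ^ i * u i`.
  obtain ⟨ε, hε, hεt⟩ : ∃ ε : ℝ, |ε| = 1 ∧ t - x = ε * |t - x| := by
    rcases le_total 0 (t - x) with h | h
    · exact ⟨1, by simp, by simp [abs_of_nonneg h]⟩
    · exact ⟨-1, by simp, by simp [abs_of_nonpos h]⟩
  have := abs_sub_taylor_le_right (M := M) k (fun i s => ε ^ i * u i (x + ε * s))
    (fun i hi s => by
      have h1 : HasDerivAt (fun s : ℝ => x + ε * s) ε s := by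
        simpa using ((hasDerivAt_id s).const_mul ε).const_add x
      have h2 := ((hu i hi (x + ε * s)).comp s h1).const_mul (ε ^ i)
      refine h2.congr_deriv ?_
      ring)
    (fun s => by rw [abs_mul, abs_pow, hε]; simpa using hM _) |t - x| (abs_nonneg _)
  rw [← hεt] at this
  simp only [pow_zero, one_mul, mul_zero, add_zero, add_sub_cancel] at this
  have h : ∀ i ∈ Finset.range k, u i x * (t - x) ^ i / (i.factorial : ℝ)
      = ε ^ i * u i x * |t - x| ^ i / (i.factorial : ℝ) := by
    intro i _
    nth_rewrite 1 [hεt]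
    rw [mul_pow]
    ring
  rwa [Finset.sum_congr rfl h]

/-! ### Moments and overlaps on a centred interval -/

/-- The uniform distribution on an interval centred at `x`. -/
noncomputable def intervalUniform (x r : ℝ) : Measure ℝ :=
  ProbabilityTheory.cond volume (Set.Icc (x - r) (x + r))

theorem isProbabilityMeasure_intervalUniform (x : ℝ) {r : ℝ} (hr : 0 < r) :
    IsProbabilityMeasure (intervalUniform x r) := by
  apply cond_isProbabilityMeasure_of_finite
  · simp [Real.volume_Icc]; linarith
  · simp [Real.volume_Icc]

theorem integral_intervalUniform (x : ℝ) {r : ℝ} (hr : 0 < r) (u : ℝ → ℝ) :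
    ∫ t, u t ∂intervalUniform x r = (2 * r)⁻¹ * ∫ t in (x - r)..(x + r), u t := by
  rw [intervalIntegral.integral_of_le (by linarith), ← integral_Icc_eq_integral_Ioc,
    intervalUniform, ProbabilityTheory.cond, integral_smul_measure, Real.volume_Icc]
  rw [show x + r - (x - r) = 2 * r by ring, ENNReal.toReal_inv,
    ENNReal.toReal_ofReal (by linarith), smul_eq_mul]

theorem integrable_intervalUniform (x : ℝ) {r : ℝ} (hr : 0 < r) {u : ℝ → ℝ} (hu : Continuous u) :
    Integrable u (intervalUniform x r) := by
  refine Integrable.smul_measure hu.continuousOn.integrableOn_Icc ?_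
  simp [Real.volume_Icc]
  linarith

theorem integral_intervalUniform_pow (x : ℝ) {r : ℝ} (hr : 0 < r) (k : ℕ) :
    ∫ t, (t - x) ^ k ∂intervalUniform x r
      = (2 * r)⁻¹ * ((r ^ (k + 1) - (-r) ^ (k + 1)) / (k + 1)) := by
  rw [integral_intervalUniform x hr,
    intervalIntegral.integral_comp_sub_right (fun t => t ^ k) x, integral_pow]
  simp

theorem integral_intervalUniform_sq (x : ℝ) {r : ℝ} (hr : 0 < r) :
    ∫ t, (t - x) ^ 2 ∂intervalUniform x r = r ^ 2 / 3 := by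
  rw [integral_intervalUniform_pow x hr]; push_cast; field_simp; ring

/-- The mean of a function over a centred interval is its central value up to the second
derivative. -/
theorem abs_integral_sub_le_of_deriv_two {u : ℕ → ℝ → ℝ} {M : ℝ} (x : ℝ) {r : ℝ} (hr : 0 < r)
    (hu : ∀ i < 2, ∀ t, HasDerivAt (u i) (u (i + 1) t) t) (hM : ∀ t, |u 2 t| ≤ M) :
    |(∫ t, u 0 t ∂intervalUniform x r) - u 0 x| ≤ r ^ 2 / 6 * M := by
  have := isProbabilityMeasure_intervalUniform x hr
  have hc : Continuous (u 0) := continuous_iff_continuousAt.2 fun t =>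
    (hu 0 (by norm_num) t).continuousAt
  have h1 : (∫ t, u 0 t ∂intervalUniform x r) - u 0 x
      = ∫ t, (u 0 t - u 0 x - u 1 x * (t - x)) ∂intervalUniform x r := by
    have e1 := integral_intervalUniform_pow x hr 1
    simp only [pow_one] at e1
    rw [integral_sub, integral_sub, integral_const_mul, e1]
    · simp
    · exact integrable_intervalUniform x hr hc
    · exact integrable_intervalUniform x hr (by fun_prop)
    · exact integrable_intervalUniform x hr (by fun_prop)
    · exact integrable_intervalUniform x hr (by fun_prop)
  have h2 : ∫ t, M / 2 * (t - x) ^ 2 ∂intervalUniform x r = r ^ 2 / 6 * M := by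
    rw [integral_const_mul, integral_intervalUniform_sq x hr]; ring
  rw [h1, ← h2, ← Real.norm_eq_abs]
  refine norm_integral_le_of_norm_le (integrable_intervalUniform x hr (by fun_prop))
    (Filter.Eventually.of_forall fun t => ?_)
  have := abs_sub_taylor_le 2 u hu hM x t
  simp only [Finset.sum_range_succ, Finset.sum_range_zero, Nat.factorial] at this
  rw [Real.norm_eq_abs]
  norm_num at this
  rw [sub_add_eq_sub_sub] at this
  linarith

/-- The centred quadratic on an interval of half-width `r`. -/
noncomputable def centredSq (x r t : ℝ) : ℝ := (t - x) ^ 2 - r ^ 2 / 3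

@[fun_prop]
theorem continuous_centredSq (x r : ℝ) : Continuous (centredSq x r) := by
  unfold centredSq; fun_prop

theorem integral_centredSq (x : ℝ) {r : ℝ} (hr : 0 < r) :
    ∫ t, centredSq x r t ∂intervalUniform x r = 0 := by
  have := isProbabilityMeasure_intervalUniform x hr
  unfold centredSq
  rw [integral_sub (integrable_intervalUniform x hr (by fun_prop)) (integrable_const _),
    integral_intervalUniform_sq x hr]
  simp

theorem integral_pow_mul_centredSq (x : ℝ) {r : ℝ} (hr : 0 < r) (k : ℕ) :
    ∫ t, (t - x) ^ k * centredSq x r t ∂intervalUniform x r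
      = (2 * r)⁻¹ * ((r ^ (k + 3) - (-r) ^ (k + 3)) / (k + 3))
        - r ^ 2 / 3 * ((2 * r)⁻¹ * ((r ^ (k + 1) - (-r) ^ (k + 1)) / (k + 1))) := by
  have h : ∀ t, (t - x) ^ k * centredSq x r t = (t - x) ^ (k + 2) - r ^ 2 / 3 * (t - x) ^ k := by
    intro t; unfold centredSq; ring
  simp only [h]
  rw [integral_sub (integrable_intervalUniform x hr (by fun_prop))
    (integrable_intervalUniform x hr (by fun_prop)), integral_const_mul,
    integral_intervalUniform_pow x hr, integral_intervalUniform_pow x hr]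
  push_cast
  ring

theorem integral_centredSq_mul_self (x : ℝ) {r : ℝ} (hr : 0 < r) :
    ∫ t, centredSq x r t * centredSq x r t ∂intervalUniform x r = 4 * r ^ 4 / 45 := by
  have h : ∀ t, centredSq x r t * centredSq x r t
      = (t - x) ^ 2 * centredSq x r t - r ^ 2 / 3 * centredSq x r t := by
    intro t; unfold centredSq; ring
  simp only [h]
  rw [integral_sub (integrable_intervalUniform x hr (by fun_prop))
    (integrable_intervalUniform x hr (by fun_prop)), integral_const_mul, integral_centredSq x hr,
    integral_pow_mul_centredSq x hr]
  push_cast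
  field_simp
  ring

theorem abs_centredSq_le {x r t : ℝ} (hr : 0 < r) (ht : t ∈ Set.Icc (x - r) (x + r)) :
    |centredSq x r t| ≤ 2 / 3 * r ^ 2 := by
  have h1 : (t - x) ^ 2 ≤ r ^ 2 := by
    rw [sq_le_sq, abs_of_pos hr, abs_le]; constructor <;> linarith [ht.1, ht.2]
  unfold centredSq
  rw [abs_le]
  constructor <;> nlinarith [sq_nonneg (t - x), sq_nonneg r]

/-- The overlap of a function with the centred quadratic is its second derivative up to the fourth
derivative. -/
theorem abs_integral_mul_centredSq_sub_le {u : ℕ → ℝ → ℝ} {M : ℝ} (x : ℝ) {r : ℝ} (hr : 0 < r)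
    (hu : ∀ i < 4, ∀ t, HasDerivAt (u i) (u (i + 1) t) t) (hM : ∀ t, |u 4 t| ≤ M) :
    |(∫ t, u 0 t * centredSq x r t ∂intervalUniform x r) - 2 * r ^ 4 / 45 * u 2 x|
      ≤ r ^ 6 / 180 * M := by
  have hc : Continuous (u 0) := continuous_iff_continuousAt.2 fun t =>
    (hu 0 (by norm_num) t).continuousAt
  -- The cubic Taylor polynomial contributes exactly `2 * r ^ 4 / 45 * u 2 x`: odd powers vanish by
  -- symmetry, the constant because `centredSq` has mean zero.
  have h1 : (∫ t, u 0 t * centredSq x r t ∂intervalUniform x r) - 2 * r ^ 4 / 45 * u 2 x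
      = ∫ t, (u 0 t * centredSq x r t
        - ∑ i ∈ Finset.range 4, u i x / (i.factorial : ℝ) * ((t - x) ^ i * centredSq x r t))
          ∂intervalUniform x r := by
    rw [integral_sub (integrable_intervalUniform x hr (by fun_prop))
      (integrable_intervalUniform x hr (by fun_prop)), integral_finsetSum]
    · congr 1
      simp only [integral_const_mul, integral_pow_mul_centredSq x hr, Finset.sum_range_succ,
        Finset.sum_range_zero, Nat.factorial]
      push_cast
      field_simp
      ring
    · intro i _
      exact integrable_intervalUniform x hr (by fun_prop)
  -- Taylor remainder times the maximum `2 / 3 * r ^ 2` of `|centredSq|`, integrated with the fourth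
  -- moment `r ^ 4 / 5`.
  have h2 : ∫ t, M / 24 * (2 / 3 * r ^ 2) * (t - x) ^ 4 ∂intervalUniform x r
      = r ^ 6 / 180 * M := by
    rw [integral_const_mul, integral_intervalUniform_pow x hr]; push_cast; field_simp; ring
  rw [h1, ← h2, ← Real.norm_eq_abs]
  refine norm_integral_le_of_norm_le (integrable_intervalUniform x hr (by fun_prop)) ?_
  filter_upwards [ae_cond_mem (μ := (volume : Measure ℝ)) (s := Set.Icc (x - r) (x + r))
    measurableSet_Icc] with t ht
  have h3 := abs_sub_taylor_le 4 u hu hM x t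
  have h4 : u 0 t * centredSq x r t
      - ∑ i ∈ Finset.range 4, u i x / (i.factorial : ℝ) * ((t - x) ^ i * centredSq x r t)
      = (u 0 t - ∑ i ∈ Finset.range 4, u i x * (t - x) ^ i / (i.factorial : ℝ))
        * centredSq x r t := by
    rw [sub_mul, Finset.sum_mul]
    congr 1
    refine Finset.sum_congr rfl fun i _ => ?_
    ring
  rw [h4, Real.norm_eq_abs, abs_mul]
  have h5 : |t - x| ^ 4 = (t - x) ^ 4 := by rw [← abs_pow]; exact abs_of_nonneg (by positivity)
  rw [h5] at h3
  calc _ ≤ (M * (t - x) ^ 4 / (Nat.factorial 4 : ℝ)) * (2 / 3 * r ^ 2) :=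
        mul_le_mul h3 (abs_centredSq_le hr ht) (abs_nonneg _) ((abs_nonneg _).trans h3)
    _ = _ := by simp [Nat.factorial]; ring

/-! ### The uniform distribution on a cube -/

section Cube

variable {m : ℕ} (φ : Fin m → ℝ)

theorem cube_eq_pi (r : ℝ) :
    cube φ r = Set.pi Set.univ fun i => Set.Icc (φ i - r) (φ i + r) := by
  ext θ; simp only [cube, Set.mem_ofPred_eq, Set.mem_pi, Set.mem_univ, true_implies]

theorem cubeUniform_eq_pi {r : ℝ} (hr : 0 < r) :
    cubeUniform φ r = Measure.pi fun i => intervalUniform (φ i) r := by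
  have := fun i => isProbabilityMeasure_intervalUniform (φ i) hr
  symm
  refine Measure.pi_eq fun s hs => ?_
  rw [cubeUniform, cond_apply, cube_eq_pi, ← Set.pi_inter_distrib, volume_pi, Measure.pi_pi,
    Measure.pi_pi]
  · simp only [intervalUniform]
    simp_rw [cond_apply measurableSet_Icc, Finset.prod_mul_distrib]
    congr 1
    refine ENNReal.prod_inv_distrib ?_
    intro i _ j _ _
    left
    simp [Real.volume_Icc]
    linarith
  · rw [cube_eq_pi]; exact MeasurableSet.univ_pi fun i => measurableSet_Icc

theorem isProbabilityMeasure_cubeUniform {r : ℝ} (hr : 0 < r) :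
    IsProbabilityMeasure (cubeUniform φ r) := by
  have := fun i => isProbabilityMeasure_intervalUniform (φ i) hr
  rw [cubeUniform_eq_pi φ hr]
  infer_instance

theorem integrable_cubeUniform {r : ℝ} (hr : 0 < r) {F : (Fin m → ℝ) → ℝ} (hF : Continuous F) :
    Integrable F (cubeUniform φ r) := by
  have hK : IsCompact (cube φ r) := by
    rw [cube_eq_pi]; exact isCompact_univ_pi fun i => isCompact_Icc
  refine Integrable.smul_measure (hF.continuousOn.integrableOn_compact hK) ?_
  rw [ENNReal.inv_ne_top, cube_eq_pi, volume_pi, Measure.pi_pi, Finset.prod_ne_zero_iff]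
  intro i _
  simp [Real.volume_Icc]
  linarith

/-- Resampling one coordinate of a product of probability measures preserves it. -/
theorem measurePreserving_update {ι : Type*} [Fintype ι] [DecidableEq ι] (ν : ι → Measure ℝ)
    [∀ i, IsProbabilityMeasure (ν i)] (l : ι) :
    MeasurePreserving (fun p : (ι → ℝ) × ℝ => Function.update p.1 l p.2)
      ((Measure.pi ν).prod (ν l)) (Measure.pi ν) := by
  have hm : Measurable (fun p : (ι → ℝ) × ℝ => Function.update p.1 l p.2) := by
    refine measurable_pi_lambda _ fun i => ?_
    by_cases h : i = l
    · subst h; simpa using measurable_snd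
    · simpa [h, Function.comp_def] using (measurable_pi_apply i).comp measurable_fst
  refine ⟨hm, (Measure.pi_eq fun s hs => ?_).symm⟩
  rw [Measure.map_apply hm (MeasurableSet.univ_pi hs)]
  -- The old coordinate `l` is overwritten, hence unconstrained, and its factor has mass one.
  have : (fun p : (ι → ℝ) × ℝ => Function.update p.1 l p.2) ⁻¹' Set.pi Set.univ s
      = (Set.pi Set.univ (Function.update s l Set.univ)) ×ˢ s l := by
    ext ⟨θ, t⟩
    simp only [Set.mem_preimage, Set.mem_pi, Set.mem_univ, true_implies, Set.mem_prod]
    constructor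
    · intro h
      refine ⟨fun i => ?_, by simpa using h l⟩
      by_cases hi : i = l
      · subst hi; simp
      · simpa [hi] using h i
    · rintro ⟨h, ht⟩ i
      by_cases hi : i = l
      · subst hi; simpa using ht
      · simpa [hi] using h i
  rw [this, Measure.prod_prod, Measure.pi_pi, ← Finset.mul_prod_erase _ _ (Finset.mem_univ l),
    ← Finset.mul_prod_erase _ _ (Finset.mem_univ l)]
  rw [Function.update_self, measure_univ, one_mul, mul_comm]
  congr 1
  refine Finset.prod_congr rfl fun i hi => ?_
  rw [Function.update_of_ne (Finset.ne_of_mem_erase hi)]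

/-- Fubini in one coordinate with the full index type kept: `θ l` is still integrated outside, but
no longer matters. -/
theorem integral_cubeUniform_resample {r : ℝ} (hr : 0 < r) {F : (Fin m → ℝ) → ℝ}
    (hF : Continuous F) (l : Fin m) :
    ∫ θ, F θ ∂cubeUniform φ r
      = ∫ θ, ∫ t, F (Function.update θ l t) ∂intervalUniform (φ l) r ∂cubeUniform φ r := by
  have := fun i => isProbabilityMeasure_intervalUniform (φ i) hr
  have hi := integrable_cubeUniform φ hr hF
  rw [cubeUniform_eq_pi φ hr] at hi ⊢
  have hp := measurePreserving_update (fun i => intervalUniform (φ i) r) l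
  rw [← integral_prod (fun p : (Fin m → ℝ) × ℝ => F (Function.update p.1 l p.2))
    (hp.integrable_comp_of_integrable hi)]
  conv_lhs => rw [← hp.map_eq]
  rw [integral_map hp.measurable.aemeasurable hF.aestronglyMeasurable]

theorem continuous_integral_update {r : ℝ} (hr : 0 < r) {F : (Fin m → ℝ) → ℝ}
    (hF : Continuous F) (l : Fin m) :
    Continuous fun θ => ∫ t, F (Function.update θ l t) ∂intervalUniform (φ l) r := by
  simp only [integral_intervalUniform _ hr]
  refine continuous_const.mul ?_
  refine intervalIntegral.continuous_parametric_intervalIntegral_of_continuous'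
    (f := fun θ t => F (Function.update θ l t)) ?_ _ _
  exact hF.comp (continuous_fst.update l continuous_snd)

theorem integral_centredSq_cubeUniform {r : ℝ} (hr : 0 < r) (l : Fin m) :
    ∫ θ, centredSq (φ l) r (θ l) ∂cubeUniform φ r = 0 := by
  rw [integral_cubeUniform_resample φ hr (by fun_prop) l]
  simp [integral_centredSq _ hr]

theorem integral_centredSq_mul_centredSq {r : ℝ} (hr : 0 < r) (l k : Fin m) :
    ∫ θ, centredSq (φ l) r (θ l) * centredSq (φ k) r (θ k) ∂cubeUniform φ r
      = if l = k then 4 * r ^ 4 / 45 else 0 := by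
  have := isProbabilityMeasure_cubeUniform φ hr
  rw [integral_cubeUniform_resample φ hr (by fun_prop) k]
  by_cases h : l = k
  · subst h
    simp [integral_centredSq_mul_self _ hr]
  · simp [h, integral_const_mul, integral_centredSq _ hr]

/-- Bessel's inequality for the orthogonal family of centred quadratics. -/
theorem sum_sq_integral_mul_centredSq_le_variance {r : ℝ} (hr : 0 < r) {f : (Fin m → ℝ) → ℝ}
    (hf : Continuous f) (Λ : Finset (Fin m)) :
    ∑ l ∈ Λ, (∫ θ, f θ * centredSq (φ l) r (θ l) ∂cubeUniform φ r) ^ 2 / (4 * r ^ 4 / 45)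
      ≤ variance f (cubeUniform φ r) := by
  have := isProbabilityMeasure_cubeUniform φ hr
  have hI : ∀ {F : (Fin m → ℝ) → ℝ}, Continuous F → Integrable F (cubeUniform φ r) :=
    fun hF => integrable_cubeUniform φ hr hF
  set v : ℝ := 4 * r ^ 4 / 45 with hv
  have hv0 : 0 < v := by positivity
  set b : Fin m → ℝ := fun l => ∫ θ, f θ * centredSq (φ l) r (θ l) ∂cubeUniform φ r with hb
  set e : ℝ := ∫ θ, f θ ∂cubeUniform φ r with he
  -- The orthogonal projection of `f` onto the span of the quadratics: its overlap with `f - e`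
  -- equals its squared norm, so expanding `(f - e - g) ^ 2` gives Bessel.
  set g : (Fin m → ℝ) → ℝ := fun θ => ∑ l ∈ Λ, b l / v * centredSq (φ l) r (θ l) with hg
  have hgc : Continuous g := by fun_prop
  have h1 : ∫ θ, (f θ - e) * g θ ∂cubeUniform φ r = ∑ l ∈ Λ, b l ^ 2 / v := by
    have : ∀ θ, (f θ - e) * g θ = ∑ l ∈ Λ, (b l / v * (f θ * centredSq (φ l) r (θ l))
        - b l / v * e * centredSq (φ l) r (θ l)) := by
      intro θ
      rw [hg, Finset.mul_sum]
      refine Finset.sum_congr rfl fun l _ => by ring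
    simp only [this]
    rw [integral_finsetSum _ fun l _ => hI (by fun_prop)]
    refine Finset.sum_congr rfl fun l _ => ?_
    rw [integral_sub (hI (by fun_prop)) (hI (by fun_prop)), integral_const_mul, integral_const_mul,
      integral_centredSq_cubeUniform φ hr]
    simp only [mul_zero, sub_zero]
    change b l / v * b l = _
    ring
  have h2 : ∫ θ, g θ * g θ ∂cubeUniform φ r = ∑ l ∈ Λ, b l ^ 2 / v := by
    have : ∀ θ, g θ * g θ = ∑ l ∈ Λ, ∑ k ∈ Λ, b l / v * (b k / v)
        * (centredSq (φ l) r (θ l) * centredSq (φ k) r (θ k)) := by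
      intro θ
      rw [hg, Finset.sum_mul_sum]
      exact Finset.sum_congr rfl fun l _ => Finset.sum_congr rfl fun k _ => by ring
    simp only [this]
    rw [integral_finsetSum _ fun l _ => hI (by fun_prop)]
    refine Finset.sum_congr rfl fun l hl => ?_
    rw [integral_finsetSum _ fun l _ => hI (by fun_prop)]
    simp only [integral_const_mul, integral_centredSq_mul_centredSq φ hr]
    simp only [mul_ite, mul_zero, Finset.sum_ite_eq, hl, if_true]
    rw [← hv]
    field_simp
  have h3 : 0 ≤ ∫ θ, (f θ - e - g θ) ^ 2 ∂cubeUniform φ r :=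
    integral_nonneg fun θ => sq_nonneg _
  have h4 : ∀ θ, (f θ - e - g θ) ^ 2 = (f θ - e) ^ 2 - 2 * ((f θ - e) * g θ) + g θ * g θ :=
    fun θ => by ring
  simp only [h4] at h3
  rw [integral_add (hI (by fun_prop)) (hI (by fun_prop)), integral_sub (hI (by fun_prop))
    (hI (by fun_prop)), integral_const_mul, h1, h2] at h3
  rw [variance_eq_integral hf.measurable.aemeasurable]
  linarith

end Cube

/-! ### Commutators and operator norms -/

section Operators

variable {n : ℕ}

/-- The commutator `X ↦ K X - X K` as a continuous real-linear map. -/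
noncomputable def commutatorCLM (K : QOp n) : QOp n →L[ℝ] QOp n :=
  ContinuousLinearMap.mul ℝ (QOp n) K - (ContinuousLinearMap.mul ℝ (QOp n)).flip K

@[simp]
theorem commutatorCLM_apply (K X : QOp n) : commutatorCLM K X = K * X - X * K := by
  simp [commutatorCLM]

/-- Used for a rotation `W` and its own generator, to pull the rotation out of the commutators. -/
theorem commutatorCLM_pow_conj {K W : QOp n} (h : Commute K W) (h' : Commute K Wᴴ) (j : ℕ)
    (X : QOp n) :
    (commutatorCLM K ^ j) (Wᴴ * X * W) = Wᴴ * (commutatorCLM K ^ j) X * W := by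
  induction j with
  | zero => simp
  | succ j ih =>
    rw [pow_succ', ContinuousLinearMap.mul_def, ContinuousLinearMap.comp_apply, ih,
      ContinuousLinearMap.comp_apply, commutatorCLM_apply, commutatorCLM_apply]
    generalize (commutatorCLM K ^ j) X = Y
    rw [mul_sub, sub_mul]
    congr 1
    · simp only [← mul_assoc]; rw [h'.eq]
    · simp only [mul_assoc]; rw [h.eq]

theorem norm_conj_of_mem_unitaryGroup {W : QOp n} (hW : W ∈ Matrix.unitaryGroup (Qubits n) ℂ)
    (X : QOp n) : ‖Wᴴ * X * W‖ = ‖X‖ := by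
  have h1 := CStarRing.norm_mul_coe_unitary (Wᴴ * X) ⟨W, hW⟩
  have h2 := CStarRing.norm_coe_unitary_mul (star (⟨W, hW⟩ : unitary (QOp n))) X
  exact h1.trans h2

theorem exists_diagonalization {H : QOp n} (hH : H.IsHermitian) :
    ∃ U ∈ Matrix.unitaryGroup (Qubits n) ℂ,
      H = Uᴴ * Matrix.diagonal (fun i => (hH.eigenvalues i : ℂ)) * U := by
  refine ⟨star (hH.eigenvectorUnitary : QOp n), Unitary.star_mem hH.eigenvectorUnitary.2, ?_⟩
  have := hH.spectral_theorem
  rw [Unitary.conjStarAlgAut_apply] at this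
  rw [← Matrix.star_eq_conjTranspose, star_star]
  exact this

theorem maxFreqOf_nonneg {H : QOp n} (hH : H.IsHermitian) : 0 ≤ maxFreqOf hH := by
  have i : Qubits n := fun _ => 0
  exact sub_nonneg.2 ((ciInf_le (Set.finite_range _).bddBelow i).trans
    (le_ciSup (Set.finite_range _).bddAbove i))

theorem maxFreqOf_le {H : QOp n} (hH : H.IsHermitian) : maxFreqOf hH ≤ 2 * ‖H‖ := by
  obtain ⟨U, hU, h⟩ := exists_diagonalization hH
  have hn : ∀ i, |hH.eigenvalues i| ≤ ‖H‖ := by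
    intro i
    have h1 : ‖H‖ = ‖fun i => (hH.eigenvalues i : ℂ)‖ := by
      conv_lhs => rw [h]
      rw [norm_conj_of_mem_unitaryGroup hU, Matrix.l2_opNorm_diagonal]
    rw [h1]
    simpa using norm_le_pi_norm (fun i => (hH.eigenvalues i : ℂ)) i
  have h2 : (⨆ i, hH.eigenvalues i) ≤ ‖H‖ := ciSup_le fun i => (le_abs_self _).trans (hn i)
  have h3 : -‖H‖ ≤ ⨅ i, hH.eigenvalues i := le_ciInf fun i => (abs_le.1 (hn i)).1
  unfold maxFreqOf
  linarith

/-- Subtracting the spectral midpoint leaves a norm of at most half the spectral width. -/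
theorem exists_norm_sub_smul_one_le {H : QOp n} (hH : H.IsHermitian) :
    ∃ c : ℂ, ‖H - c • (1 : QOp n)‖ ≤ maxFreqOf hH / 2 := by
  obtain ⟨U, hU, h⟩ := exists_diagonalization hH
  set c : ℝ := ((⨆ i, hH.eigenvalues i) + ⨅ i, hH.eigenvalues i) / 2 with hc
  refine ⟨(c : ℂ), ?_⟩
  have hUU : Uᴴ * U = 1 := hU.1
  have h1 : H - (c : ℂ) • (1 : QOp n)
      = Uᴴ * Matrix.diagonal (fun i => ((hH.eigenvalues i - c : ℝ) : ℂ)) * U := by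
    have h2 : Matrix.diagonal (fun i => ((hH.eigenvalues i - c : ℝ) : ℂ))
        = Matrix.diagonal (fun i => (hH.eigenvalues i : ℂ)) - (c : ℂ) • (1 : QOp n) := by
      rw [← Matrix.diagonal_one, ← Matrix.diagonal_smul, Matrix.diagonal_sub]
      congr 1
      ext i
      simp
    rw [h2, mul_sub, sub_mul, ← h, mul_smul_comm, smul_mul_assoc, mul_one, hUU]
  rw [h1, norm_conj_of_mem_unitaryGroup hU, Matrix.l2_opNorm_diagonal,
    pi_norm_le_iff_of_nonneg (by linarith [maxFreqOf_nonneg hH])]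
  intro i
  have h3 := ciInf_le (f := hH.eigenvalues) (Set.finite_range _).bddBelow i
  have h4 := le_ciSup (f := hH.eigenvalues) (Set.finite_range _).bddAbove i
  rw [Complex.norm_real, Real.norm_eq_abs, abs_le]
  unfold maxFreqOf
  constructor <;> linarith

/-- A commutator does not see scalars, so `H` may be shifted to its spectral midpoint. The shifted
norm is at most half the spectral width, and it enters twice. -/
theorem norm_commutatorCLM_le {H : QOp n} (hH : H.IsHermitian) (X : QOp n) :
    ‖commutatorCLM (Complex.I • H) X‖ ≤ maxFreqOf hH * ‖X‖ := by
  obtain ⟨c, hc⟩ := exists_norm_sub_smul_one_le hH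
  have h1 : commutatorCLM (Complex.I • H) X
      = Complex.I • ((H - c • (1 : QOp n)) * X - X * (H - c • (1 : QOp n))) := by
    rw [commutatorCLM_apply]
    simp only [sub_mul, mul_sub, smul_mul_assoc, mul_smul_comm, one_mul, mul_one, smul_sub]
    abel
  rw [h1, norm_smul, Complex.norm_I, one_mul]
  refine (norm_sub_le _ _).trans ?_
  have h2 := norm_mul_le (H - c • (1 : QOp n)) X
  have h3 := norm_mul_le X (H - c • (1 : QOp n))
  nlinarith [norm_nonneg X]

theorem norm_commutatorCLM_pow_le {H : QOp n} (hH : H.IsHermitian) (s : ℕ) (X : QOp n) :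
    ‖(commutatorCLM (Complex.I • H) ^ s) X‖ ≤ maxFreqOf hH ^ s * ‖X‖ := by
  induction s with
  | zero => simp
  | succ s ih =>
    rw [pow_succ', ContinuousLinearMap.mul_def, ContinuousLinearMap.comp_apply, pow_succ', mul_assoc]
    exact (norm_commutatorCLM_le hH _).trans
      (mul_le_mul_of_nonneg_left ih (maxFreqOf_nonneg hH))

theorem norm_apply_le_l2_opNorm (X : QOp n) (i j : Qubits n) : ‖X i j‖ ≤ ‖X‖ := by
  have h := Matrix.l2_opNorm_mulVec X (EuclideanSpace.single j (1 : ℂ))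
  rw [PiLp.norm_single, norm_one, mul_one] at h
  refine le_trans ?_ h
  have := PiLp.norm_apply_le (WithLp.toLp 2 (X *ᵥ (EuclideanSpace.single j (1 : ℂ)).ofLp)) i
  simpa using this

/-- Expectation values in a state are bounded by the operator norm. -/
theorem abs_re_trace_mul_le {ρ : QOp n} (hρ : ρ.PosSemidef) (h1 : ρ.trace = 1) (X : QOp n) :
    |(ρ * X).trace.re| ≤ ‖X‖ := by
  obtain ⟨U, hU, h⟩ := exists_diagonalization hρ.1
  set p := hρ.1.eigenvalues with hp
  have hs : ∑ i, p i = 1 := by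
    have := hρ.1.trace_eq_sum_eigenvalues
    rw [h1] at this
    have h2 := congrArg Complex.re this
    simpa using h2.symm
  have hY : ‖U * X * Uᴴ‖ = ‖X‖ := by
    have := norm_conj_of_mem_unitaryGroup (Unitary.star_mem hU) X
    rwa [Matrix.star_eq_conjTranspose, Matrix.conjTranspose_conjTranspose] at this
  have ht : (ρ * X).trace = ∑ i, (p i : ℂ) * (U * X * Uᴴ) i i := by
    rw [h, mul_assoc, mul_assoc, Matrix.trace_mul_comm, mul_assoc]
    simp [Matrix.trace, Matrix.diagonal_mul]
  rw [ht]
  refine (Complex.abs_re_le_norm _).trans ((norm_sum_le _ _).trans ?_)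
  calc ∑ i, ‖(p i : ℂ) * (U * X * Uᴴ) i i‖ ≤ ∑ i, p i * ‖X‖ := by
        refine Finset.sum_le_sum fun i _ => ?_
        have h0 : 0 ≤ p i := hρ.eigenvalues_nonneg i
        rw [norm_mul, Complex.norm_real, Real.norm_eq_abs, abs_of_nonneg h0, ← hY]
        exact mul_le_mul_of_nonneg_left (norm_apply_le_l2_opNorm _ i i) h0
    _ = ‖X‖ := by rw [← Finset.sum_mul, hs, one_mul]

end Operators

/-! ### Derivatives of the back-propagated observable and of the loss -/

namespace VarProblem

variable {n m : ℕ} (P : VarProblem n m)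

theorem conjTranspose_exp_gen (l : Fin m) (t : ℝ) :
    (NormedSpace.exp ((-(Complex.I * (t : ℂ))) • P.gen l))ᴴ
      = NormedSpace.exp (t • (Complex.I • P.gen l)) := by
  rw [← Matrix.exp_conjTranspose, Matrix.conjTranspose_smul, (P.gen_isHermitian l).eq]
  congr 1
  rw [← Complex.coe_smul, smul_smul]
  congr 1
  simp [mul_comm]

theorem exp_gen_eq (l : Fin m) (t : ℝ) :
    NormedSpace.exp ((-(Complex.I * (t : ℂ))) • P.gen l)
      = NormedSpace.exp (t • (-(Complex.I • P.gen l))) := by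
  congr 1
  rw [← Complex.coe_smul, smul_neg, smul_smul, neg_smul, mul_comm]

theorem exp_gen_mem_unitaryGroup (l : Fin m) (t : ℝ) :
    NormedSpace.exp ((-(Complex.I * (t : ℂ))) • P.gen l) ∈ Matrix.unitaryGroup (Qubits n) ℂ := by
  rw [Matrix.mem_unitaryGroup_iff', Matrix.star_eq_conjTranspose, conjTranspose_exp_gen,
    exp_gen_eq, ← Matrix.exp_add_of_commute, smul_neg, add_neg_cancel, NormedSpace.exp_zero]
  rw [smul_neg]
  exact (Commute.refl _).neg_right

theorem gate_mem_unitaryGroup (l : Fin m) (t : ℝ) :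
    P.gate l t ∈ Matrix.unitaryGroup (Qubits n) ℂ :=
  mul_mem (P.fixedGate_unitary l) (P.exp_gen_mem_unitaryGroup l t)

/-- The derivation `X ↦ i [H_l, X]`. -/
noncomputable def adGen (l : Fin m) : QOp n →L[ℝ] QOp n := commutatorCLM (Complex.I • P.gen l)

theorem norm_adGen_pow_le (l : Fin m) (s : ℕ) (X : QOp n) :
    ‖(P.adGen l ^ s) X‖ ≤ P.maxFreq l ^ s * ‖X‖ :=
  norm_commutatorCLM_pow_le (P.gen_isHermitian l) s X

/-- The rotation commutes with its generator, so it moves outside the commutators and disappears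
from the norm; only the fixed gate remains. -/
theorem norm_adGen_pow_gate_conj (l : Fin m) (s : ℕ) (t : ℝ) (X : QOp n) :
    ‖(P.adGen l ^ s) ((P.gate l t)ᴴ * X * P.gate l t)‖
      = ‖(P.adGen l ^ s) ((P.fixedGate l)ᴴ * X * P.fixedGate l)‖ := by
  set E := NormedSpace.exp ((-(Complex.I * (t : ℂ))) • P.gen l) with hE
  have hc : Commute (Complex.I • P.gen l) E := by
    rw [hE, exp_gen_eq]
    exact (((Commute.refl _).neg_right).smul_right t).exp_right
  have hc' : Commute (Complex.I • P.gen l) Eᴴ := by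
    rw [hE, conjTranspose_exp_gen]
    exact ((Commute.refl _).smul_right t).exp_right
  have h1 : (P.gate l t)ᴴ * X * P.gate l t
      = Eᴴ * ((P.fixedGate l)ᴴ * X * P.fixedGate l) * E := by
    rw [gate, Matrix.conjTranspose_mul]; simp only [mul_assoc, hE]
  rw [h1, adGen, commutatorCLM_pow_conj hc hc',
    norm_conj_of_mem_unitaryGroup (P.exp_gen_mem_unitaryGroup l t)]

theorem hasDerivAt_gate (l : Fin m) (t : ℝ) :
    HasDerivAt (P.gate l) (P.gate l t * -(Complex.I • P.gen l)) t := by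
  unfold gate
  simp only [exp_gen_eq]
  rw [mul_assoc]
  exact (hasDerivAt_exp_smul_const (𝕂 := ℝ) (-(Complex.I • P.gen l)) t).const_mul _

theorem hasDerivAt_conjTranspose_gate (l : Fin m) (t : ℝ) :
    HasDerivAt (fun t => (P.gate l t)ᴴ) ((Complex.I • P.gen l) * (P.gate l t)ᴴ) t := by
  unfold gate
  simp only [Matrix.conjTranspose_mul, conjTranspose_exp_gen]
  rw [← mul_assoc]
  exact (hasDerivAt_exp_smul_const' (𝕂 := ℝ) (Complex.I • P.gen l) t).mul_const _

theorem hasDerivAt_gate_conj (l : Fin m) (X : QOp n) (t : ℝ) :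
    HasDerivAt (fun t => (P.gate l t)ᴴ * X * P.gate l t)
      (P.adGen l ((P.gate l t)ᴴ * X * P.gate l t)) t := by
  refine (((P.hasDerivAt_conjTranspose_gate l t).mul_const X).mul
    (P.hasDerivAt_gate l t)).congr_deriv ?_
  rw [adGen, commutatorCLM_apply]
  simp only [mul_assoc, mul_neg, sub_eq_add_neg]

theorem continuous_gate (l : Fin m) : Continuous (P.gate l) :=
  continuous_iff_continuousAt.2 fun t => (P.hasDerivAt_gate l t).continuousAt

/-- The observable back-propagated through the first `k` gates, differentiated `j l` times with
respect to the `l`-th parameter. -/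
noncomputable def jet (j : Fin m → ℕ) (θ : Fin m → ℝ) : ℕ → QOp n
  | 0 => P.obs
  | k + 1 => if h : k < m then
      (P.adGen ⟨k, h⟩ ^ j ⟨k, h⟩)
        ((P.gate ⟨k, h⟩ (θ ⟨k, h⟩))ᴴ * jet j θ k * P.gate ⟨k, h⟩ (θ ⟨k, h⟩))
    else jet j θ k

theorem jet_succ {k : ℕ} (h : k < m) (j : Fin m → ℕ) (θ : Fin m → ℝ) :
    P.jet j θ (k + 1) = (P.adGen ⟨k, h⟩ ^ j ⟨k, h⟩)
      ((P.gate ⟨k, h⟩ (θ ⟨k, h⟩))ᴴ * P.jet j θ k * P.gate ⟨k, h⟩ (θ ⟨k, h⟩)) := by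
  rw [jet, dif_pos h]

theorem jet_congr {j j' : Fin m → ℕ} {θ θ' : Fin m → ℝ} {k : ℕ}
    (hj : ∀ i : Fin m, (i : ℕ) < k → j i = j' i) (hθ : ∀ i : Fin m, (i : ℕ) < k → θ i = θ' i) :
    P.jet j θ k = P.jet j' θ' k := by
  induction k with
  | zero => rfl
  | succ k ih =>
    have e := ih (fun i hi => hj i (by omega)) (fun i hi => hθ i (by omega))
    by_cases h : k < m
    · rw [jet_succ P h, jet_succ P h, e, hj ⟨k, h⟩ (by simp), hθ ⟨k, h⟩ (by simp)]
    · rw [jet, jet, dif_neg h, dif_neg h, e]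

theorem continuous_jet (j : Fin m → ℕ) (k : ℕ) : Continuous fun θ => P.jet j θ k := by
  induction k with
  | zero => exact continuous_const
  | succ k ih =>
    by_cases h : k < m
    · simp only [jet_succ P h]
      have hg : Continuous fun θ : Fin m → ℝ => P.gate ⟨k, h⟩ (θ ⟨k, h⟩) :=
        (P.continuous_gate _).comp (continuous_apply _)
      exact (P.adGen ⟨k, h⟩ ^ j ⟨k, h⟩).continuous.comp
        ((hg.matrix_conjTranspose.mul ih).mul hg)
    · simpa only [jet, dif_neg h] using ih

theorem hasDerivAt_conj {f : ℝ → QOp n} {f' : QOp n} {t : ℝ} (hf : HasDerivAt f f' t)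
    (W : QOp n) : HasDerivAt (fun t => Wᴴ * f t * W) (Wᴴ * f' * W) t :=
  (hf.const_mul Wᴴ).mul_const W

/-- Gates before `l` do not see `t`, gate `l` yields one more commutator, and later gates act by
fixed linear maps. -/
theorem hasDerivAt_jet (j : Fin m → ℕ) (θ : Fin m → ℝ) (l : Fin m) {k : ℕ} (hk : (l : ℕ) < k)
    (t : ℝ) :
    HasDerivAt (fun t => P.jet j (Function.update θ l t) k)
      (P.jet (Function.update j l (j l + 1)) (Function.update θ l t) k) t := by
  induction k, hk using Nat.le_induction with
  | base =>
    have hX : ∀ s, P.jet j (Function.update θ l s) l = P.jet j θ l := fun s =>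
      P.jet_congr (fun _ _ => rfl) fun i hi => by
        rw [Function.update_of_ne]; intro h; simp [h] at hi
    have hX' : ∀ s, P.jet (Function.update j l (j l + 1)) (Function.update θ l s) l
        = P.jet j θ l := fun s =>
      P.jet_congr (fun i hi => by rw [Function.update_of_ne]; intro h; simp [h] at hi)
        fun i hi => by rw [Function.update_of_ne]; intro h; simp [h] at hi
    simp only [Nat.succ_eq_add_one, jet_succ P l.2, Fin.eta, Function.update_self, hX, hX',
      pow_succ]
    exact (P.adGen l ^ j l).hasFDerivAt.comp_hasDerivAt t (P.hasDerivAt_gate_conj l _ t)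
  | succ k hk ih =>
    by_cases h : k < m
    · have hne : (⟨k, h⟩ : Fin m) ≠ l := fun e => by
        have := congrArg Fin.val e
        simp at this
        omega
      simp only [jet_succ P h, Function.update_of_ne hne]
      exact (P.adGen ⟨k, h⟩ ^ j ⟨k, h⟩).hasFDerivAt.comp_hasDerivAt t (hasDerivAt_conj ih _)
    · simpa only [jet, dif_neg h] using ih

theorem norm_jet_of_le {j : Fin m → ℕ} (θ : Fin m → ℝ) {k k' : ℕ} (hk : k ≤ k')
    (hj : ∀ i : Fin m, k ≤ (i : ℕ) → j i = 0) : ‖P.jet j θ k'‖ = ‖P.jet j θ k‖ := by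
  induction k', hk using Nat.le_induction with
  | base => rfl
  | succ k' hk' ih =>
    by_cases h : k' < m
    · rw [jet_succ P h, hj ⟨k', h⟩ hk', pow_zero, one_apply_eq_self,
        norm_conj_of_mem_unitaryGroup (P.gate_mem_unitaryGroup _ _), ih]
    · rw [jet, dif_neg h, ih]

/-- The norm of a jet only depends on the parameters before the last differentiated one. -/
theorem norm_jet_congr {j : Fin m → ℕ} {θ θ' : Fin m → ℝ} (l : Fin m)
    (hj : ∀ i, l < i → j i = 0) (hθ : ∀ i, i < l → θ i = θ' i) :
    ‖P.jet j θ m‖ = ‖P.jet j θ' m‖ := by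
  have h : ∀ i : Fin m, (l : ℕ) + 1 ≤ i → j i = 0 := fun i hi => hj i (by omega)
  rw [P.norm_jet_of_le θ l.2 h, P.norm_jet_of_le θ' l.2 h]
  simp only [Nat.succ_eq_add_one]
  rw [jet_succ P l.2, jet_succ P l.2, norm_adGen_pow_gate_conj, norm_adGen_pow_gate_conj,
    P.jet_congr (fun _ _ => rfl) fun i hi => hθ i hi]

/-- Since `j` differentiates nothing beyond `l`, the new commutators are outermost up to unitary
conjugation, and each costs a factor `maxFreq l`. -/
theorem norm_jet_add_le {j j' : Fin m → ℕ} (θ : Fin m → ℝ) (l : Fin m) {s : ℕ}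
    (hj : ∀ i, l < i → j i = 0) (hj' : j' = Function.update j l (j l + s)) :
    ‖P.jet j' θ m‖ ≤ P.maxFreq l ^ s * ‖P.jet j θ m‖ := by
  have h : ∀ i : Fin m, (l : ℕ) + 1 ≤ i → j i = 0 := fun i hi => hj i (by omega)
  have h' : ∀ i : Fin m, (l : ℕ) + 1 ≤ i → j' i = 0 := fun i hi => by
    rw [hj', Function.update_of_ne (by intro e; simp [e] at hi)]; exact h i hi
  rw [P.norm_jet_of_le θ l.2 h, P.norm_jet_of_le θ l.2 h']
  simp only [Nat.succ_eq_add_one]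
  rw [jet_succ P l.2, jet_succ P l.2, P.jet_congr (j := j') (j' := j) (θ' := θ)
    (fun i hi => by rw [hj', Function.update_of_ne]; intro e; simp [e] at hi) fun _ _ => rfl]
  simp only [Fin.eta]
  rw [hj', Function.update_self, add_comm, pow_add, ContinuousLinearMap.mul_def,
    ContinuousLinearMap.comp_apply]
  exact P.norm_adGen_pow_le l s _

theorem norm_jet_zero (θ : Fin m → ℝ) : ‖P.jet 0 θ m‖ = ‖P.obs‖ :=
  (P.norm_jet_of_le (j := 0) θ (Nat.zero_le m) fun _ _ => rfl).trans (by rw [jet])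

theorem jet_zero_eq_heisenberg (θ : Fin m → ℝ) : P.jet 0 θ m = P.heisenberg θ := by
  have key : ∀ k ≤ m, P.jet 0 θ k
      = (((List.ofFn fun l => P.gate l (θ l)).take k).prod)ᴴ * P.obs
        * ((List.ofFn fun l => P.gate l (θ l)).take k).prod := by
    intro k
    induction k with
    | zero => intro _; simp [jet]
    | succ k ih =>
      intro hk
      have hk' : k < m := hk
      rw [jet_succ P hk', ih hk'.le, Pi.zero_apply, pow_zero, one_apply_eq_self,
        List.prod_take_succ _ _ (by simpa using hk'), Matrix.conjTranspose_mul]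
      simp only [List.getElem_ofFn, mul_assoc]
  have := key m le_rfl
  rw [List.take_of_length_le (by simp)] at this
  exact this

/-- The multi-index differentiating `s` times in the direction `l`. -/
abbrev singleIdx (l : Fin m) (s : ℕ) : Fin m → ℕ := Function.update 0 l s

/-- The multi-index differentiating twice in each of the distinct directions `l` and `μ`. -/
abbrev pairIdx (l μ : Fin m) : Fin m → ℕ := Function.update (singleIdx l 2) μ 2

theorem iteratedDeriv_two_of_hasDerivAt {E : Type*} [NormedAddCommGroup E] [NormedSpace ℝ E]
    {f f' f'' : ℝ → E} (h : ∀ t, HasDerivAt f (f' t) t) (h' : ∀ t, HasDerivAt f' (f'' t) t) :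
    iteratedDeriv 2 f = f'' := by
  rw [iteratedDeriv_succ, iteratedDeriv_one, funext fun t => (h t).deriv]
  exact funext fun t => (h' t).deriv

theorem iteratedDeriv_two_jet (j : Fin m → ℕ) (θ : Fin m → ℝ) (l : Fin m) :
    iteratedDeriv 2 (fun t => P.jet j (Function.update θ l t) m)
      = fun t => P.jet (Function.update j l (j l + 2)) (Function.update θ l t) m := by
  refine iteratedDeriv_two_of_hasDerivAt (fun t => P.hasDerivAt_jet j θ l l.2 t) fun t => ?_
  have := P.hasDerivAt_jet (Function.update j l (j l + 1)) θ l l.2 t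
  simpa [add_assoc] using this

theorem partialSq_jet (j : Fin m → ℕ) (l : Fin m) :
    partialSq l (fun θ => P.jet j θ m)
      = fun θ => P.jet (Function.update j l (j l + 2)) θ m := by
  ext1 θ
  rw [partialSq, iteratedDeriv_two_jet]
  simp

theorem partialSq_heisenberg (l : Fin m) :
    partialSq l P.heisenberg = fun θ => P.jet (singleIdx l 2) θ m := by
  rw [← funext P.jet_zero_eq_heisenberg, partialSq_jet]
  simp

theorem effFreq_sq (φ : Fin m → ℝ) (μ : Fin m) :
    P.effFreq φ μ ^ 2 = ‖P.jet (singleIdx μ 2) φ m‖ := by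
  rw [effFreq, Real.sq_sqrt (norm_nonneg _), partialSq_heisenberg]

/-- Distinctness matters: for equal labels `pairIdx` overwrites its entry and records two
derivatives where four are taken. -/
theorem effFreq₂_sq (φ : Fin m → ℝ) {l μ : Fin m} (h : l ≠ μ) :
    P.effFreq₂ φ l μ ^ 2 = ‖P.jet (pairIdx l μ) φ m‖ := by
  rw [effFreq₂, Real.sq_sqrt (norm_nonneg _), partialSq_heisenberg, partialSq_jet]
  simp [pairIdx, h.symm]

/-- The expectation value in the input state. -/
noncomputable def expectation : QOp n →L[ℝ] ℝ :=
  LinearMap.mkContinuous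
    { toFun := fun X => (P.state * X).trace.re
      map_add' := fun X Y => by rw [mul_add, Matrix.trace_add, Complex.add_re]
      map_smul' := fun c X => by
        rw [mul_smul_comm, Matrix.trace_smul, Complex.smul_re, RingHom.id_apply] } 1
    fun X => by
      rw [one_mul]; exact abs_re_trace_mul_le P.state_posSemidef P.state_trace X

theorem abs_expectation_le (X : QOp n) : |P.expectation X| ≤ ‖X‖ :=
  abs_re_trace_mul_le P.state_posSemidef P.state_trace X

/-- The derivatives of the loss. -/
noncomputable def lossJet (j : Fin m → ℕ) (θ : Fin m → ℝ) : ℝ := P.expectation (P.jet j θ m)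

theorem lossJet_zero (θ : Fin m → ℝ) : P.lossJet 0 θ = P.loss θ := by
  rw [lossJet, jet_zero_eq_heisenberg, heisenberg, loss]
  change (P.state * _).trace.re = _
  congr 1
  have h : P.circuit θ * P.state * (P.circuit θ)ᴴ * P.obs
      = P.circuit θ * (P.state * (P.circuit θ)ᴴ * P.obs) := by simp only [mul_assoc]
  rw [h, Matrix.trace_mul_comm (P.circuit θ)]
  simp only [mul_assoc]

theorem continuous_lossJet (j : Fin m → ℕ) : Continuous (P.lossJet j) :=
  P.expectation.continuous.comp (P.continuous_jet j m)

theorem hasDerivAt_lossJet (j : Fin m → ℕ) (θ : Fin m → ℝ) (l : Fin m) (s : ℕ) (t : ℝ) :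
    HasDerivAt (fun t => P.lossJet (Function.update j l s) (Function.update θ l t))
      (P.lossJet (Function.update j l (s + 1)) (Function.update θ l t)) t := by
  have := P.expectation.hasFDerivAt.comp_hasDerivAt t
    (P.hasDerivAt_jet (Function.update j l s) θ l l.2 t)
  simp only [Function.update_self, Function.update_idem] at this
  exact this

theorem curv_eq (φ : Fin m → ℝ) (l : Fin m) :
    P.curv φ l = |P.lossJet (singleIdx l 2) φ| := by
  have h : P.loss = P.lossJet (Function.update 0 l 0) := by
    ext θ; rw [← lossJet_zero]; simp
  rw [curv, partialSq, h, iteratedDeriv_two_of_hasDerivAt (P.hasDerivAt_lossJet 0 φ l 0)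
    (P.hasDerivAt_lossJet 0 φ l 1)]
  simp

theorem abs_lossJet_le (j : Fin m → ℕ) (θ : Fin m → ℝ) : |P.lossJet j θ| ≤ ‖P.jet j θ m‖ :=
  P.abs_expectation_le _

end VarProblem

/-! ### Freezing coordinates one at a time -/

/-- Comparing a mean over the cube with the central value, one coordinate at a time. -/
theorem abs_integral_cubeUniform_sub_le {m : ℕ} (φ : Fin m → ℝ) {r : ℝ} (hr : 0 < r)
    {h : (Fin m → ℝ) → ℝ} (hc : Continuous h) {C : Fin m → ℝ}
    (H : ∀ μ θ, (∀ i, i < μ → θ i = φ i) →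
      |(∫ t, h (Function.update θ μ t) ∂intervalUniform (φ μ) r)
        - h (Function.update θ μ (φ μ))| ≤ C μ) :
    |(∫ θ, h θ ∂cubeUniform φ r) - h φ| ≤ ∑ μ, C μ := by
  have hprob := isProbabilityMeasure_cubeUniform φ hr
  -- Puts the first `k` coordinates at `φ`. Telescoping over `k` in increasing order is what lets
  -- `H` assume agreement with `φ` before `μ`.
  let fr : ℕ → (Fin m → ℝ) → (Fin m → ℝ) := fun k θ i => if (i : ℕ) < k then φ i else θ i
  have hfr : ∀ k, Continuous (fr k) := fun k => continuous_pi fun i => by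
    by_cases hi : (i : ℕ) < k
    · simpa [fr, hi] using continuous_const
    · simpa [fr, hi] using continuous_apply i
  have hupd : ∀ (k : ℕ) (hk : k < m) θ t, fr k (Function.update θ ⟨k, hk⟩ t)
      = Function.update (fr k θ) ⟨k, hk⟩ t := by
    intro k hk θ t
    ext i
    by_cases hi : i = ⟨k, hk⟩
    · subst hi; simp [fr]
    · simp [fr, hi]
  have hsucc : ∀ (k : ℕ) (hk : k < m) θ, fr (k + 1) θ
      = Function.update (fr k θ) ⟨k, hk⟩ (φ ⟨k, hk⟩) := by
    intro k hk θ
    ext i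
    by_cases hi : i = ⟨k, hk⟩
    · subst hi; simp [fr]
    · have : (i : ℕ) ≠ k := fun e => hi (Fin.ext e)
      have h2 : (i : ℕ) < k + 1 ↔ (i : ℕ) < k := by omega
      simp [fr, hi, h2]
  have key : ∀ k ≤ m, |(∫ θ, h θ ∂cubeUniform φ r) - ∫ θ, h (fr k θ) ∂cubeUniform φ r|
      ≤ ∑ i ∈ Finset.range k, if hi : i < m then C ⟨i, hi⟩ else 0 := by
    intro k
    induction k with
    | zero => intro _; simp [fr]
    | succ k ih =>
      intro hk
      have hk' : k < m := hk
      have hstep : |(∫ θ, h (fr k θ) ∂cubeUniform φ r) - ∫ θ, h (fr (k + 1) θ) ∂cubeUniform φ r|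
          ≤ C ⟨k, hk'⟩ := by
        have hck : Continuous fun θ => h (fr k θ) := hc.comp (hfr k)
        rw [integral_cubeUniform_resample φ hr hck ⟨k, hk'⟩, ← integral_sub
          (integrable_cubeUniform φ hr (continuous_integral_update φ hr hck _))
          (integrable_cubeUniform φ hr (F := fun θ => h (fr (k + 1) θ)) (hc.comp (hfr _)))]
        have := norm_integral_le_of_norm_le_const (μ := cubeUniform φ r)
          (f := fun θ => (∫ t, h (fr k (Function.update θ ⟨k, hk'⟩ t))
            ∂intervalUniform (φ ⟨k, hk'⟩) r) - h (fr (k + 1) θ)) (C := C ⟨k, hk'⟩)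
          (Filter.Eventually.of_forall fun θ => by
            simp only [hupd, hsucc k hk']
            refine H ⟨k, hk'⟩ (fr k θ) fun i hi => ?_
            simp [fr, Fin.lt_def.1 hi])
        simpa using this
      rw [Finset.sum_range_succ, dif_pos hk']
      exact (abs_sub_le _ _ _).trans (add_le_add (ih hk'.le) hstep)
  have hlast : ∀ θ, fr m θ = φ := fun θ => by ext i; simp [fr]
  have := key m le_rfl
  simp only [hlast] at this
  rw [Finset.sum_range] at this
  simpa using this

/-! ### Variance bounds inside the patch -/

namespace VarProblem

variable {n m : ℕ} (P : VarProblem n m) (φ : Fin m → ℝ)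

theorem maxFreq_nonneg (l : Fin m) : 0 ≤ P.maxFreq l := maxFreqOf_nonneg _

theorem freqSum_nonneg (l : Fin m) : 0 ≤ P.freqSum φ l := by
  unfold freqSum
  positivity

theorem beta_nonneg (l : Fin m) : 0 ≤ P.beta φ l := by
  have := P.maxFreq_nonneg l
  unfold beta
  split_ifs <;> positivity

theorem norm_jet_singleIdx_two_le (θ : Fin m → ℝ) (l : Fin m) :
    ‖P.jet (singleIdx l 2) θ m‖ ≤ P.maxFreq l ^ 2 * ‖P.obs‖ := by
  have := P.norm_jet_add_le (j := 0) (j' := singleIdx l 2) θ l (s := 2) (fun _ _ => rfl)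
    (by simp)
  rwa [norm_jet_zero] at this

theorem norm_jet_singleIdx_four_le (θ : Fin m → ℝ) (l : Fin m) :
    ‖P.jet (singleIdx l 4) θ m‖ ≤ P.maxFreq l ^ 2 * ‖P.jet (singleIdx l 2) θ m‖ :=
  P.norm_jet_add_le θ l (s := 2) (fun i hi => by simp [hi.ne']) (by simp)

theorem norm_jet_pairIdx_le (θ : Fin m → ℝ) {l μ : Fin m} (h : μ < l) :
    ‖P.jet (pairIdx l μ) θ m‖ ≤ P.maxFreq l ^ 2 * ‖P.jet (singleIdx μ 2) θ m‖ :=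
  P.norm_jet_add_le θ l (s := 2) (fun i hi => by simp [(h.trans hi).ne'])
    (by simp [pairIdx, Function.update_comm h.ne, h.ne'])

theorem curv_le (l : Fin m) : P.curv φ l ≤ P.maxFreq l ^ 2 * ‖P.obs‖ := by
  rw [curv_eq]
  exact (P.abs_lossJet_le _ _).trans (P.norm_jet_singleIdx_two_le φ l)

/-- A uniform bound on the second derivative, controlled by `beta`. -/
theorem exists_norm_jet_le (l : Fin m) : ∃ K, (∀ θ, ‖P.jet (singleIdx l 2) θ m‖ ≤ K) ∧
    P.maxFreq l ^ 2 * K ^ 2 ≤ 4 * P.beta φ l := by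
  by_cases h : (l : ℕ) = 0
  -- No parameter precedes the first label, so this norm is constant in `θ`; hence the separate
  -- value of `beta`.
  · refine ⟨‖P.jet (singleIdx l 2) φ m‖, fun θ => (P.norm_jet_congr l
      (fun i hi => by simp [hi.ne']) fun i hi => ?_).le, ?_⟩
    · have := Fin.lt_def.1 hi
      omega
    · rw [beta, if_pos h, ← effFreq_sq]
      nlinarith [sq_nonneg (P.maxFreq l * P.effFreq φ l ^ 2)]
  · refine ⟨P.maxFreq l ^ 2 * ‖P.obs‖, fun θ => P.norm_jet_singleIdx_two_le θ l, ?_⟩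
    rw [beta, if_neg h]
    nlinarith [sq_nonneg (P.maxFreq l ^ 3 * ‖P.obs‖)]

/-- The averaged second derivative differs from its central value by at most
`freqSum * r ^ 2 / 6`. -/
theorem abs_integral_lossJet_sub_le {r : ℝ} (hr : 0 < r) (l : Fin m) :
    |(∫ θ, P.lossJet (singleIdx l 2) (Function.update θ l (φ l)) ∂cubeUniform φ r)
      - P.lossJet (singleIdx l 2) φ| ≤ 1 / 6 * P.freqSum φ l * r ^ 2 := by
  set M : Fin m → ℝ := fun μ => (if μ < l then 4 * P.maxFreq l ^ 2 * P.effFreq φ μ ^ 2 else 0)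
    + (if l < μ then P.effFreq₂ φ l μ ^ 2 else 0) with hM
  have hsum : ∑ μ, r ^ 2 / 6 * M μ = 1 / 6 * P.freqSum φ l * r ^ 2 := by
    have h1 : Finset.univ.filter (fun μ => μ < l) = Finset.Iio l := by ext; simp
    have h2 : Finset.univ.filter (fun μ => l < μ) = Finset.Ioi l := by ext; simp
    rw [← Finset.mul_sum, hM, Finset.sum_add_distrib, ← Finset.sum_filter, ← Finset.sum_filter,
      freqSum, Finset.mul_sum, h1, h2]
    ring
  have hc : Continuous fun θ : Fin m → ℝ =>
      P.lossJet (singleIdx l 2) (Function.update θ l (φ l)) :=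
    (P.continuous_lossJet _).comp (continuous_id.update l continuous_const)
  have := abs_integral_cubeUniform_sub_le φ hr hc (C := fun μ => r ^ 2 / 6 * M μ) ?_
  · rwa [Function.update_eq_self, hsum] at this
  intro μ θ hθ
  -- The coordinate `l` is pinned at `φ l` already and costs nothing.
  by_cases hμ : μ = l
  · subst hμ
    have := isProbabilityMeasure_intervalUniform (φ μ) hr
    simp [hM]
  have hcomm : ∀ t, Function.update (Function.update θ μ t) l (φ l)
      = Function.update (Function.update θ l (φ l)) μ t := fun t => Function.update_comm hμ _ _ _
  simp only [hcomm]
  set θ' := Function.update θ l (φ l) with hθ'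
  have hθφ : ∀ t i, i < μ → Function.update θ' μ t i = φ i := by
    intro t i hi
    rw [Function.update_of_ne hi.ne]
    by_cases hil : i = l
    · subst hil; simp [hθ']
    · rw [hθ', Function.update_of_ne hil, hθ i hi]
  have hb : ∀ t, |P.lossJet (Function.update (singleIdx l 2) μ 2) (Function.update θ' μ t)|
      ≤ M μ := by
    intro t
    refine (P.abs_lossJet_le _ _).trans ?_
    rcases lt_or_gt_of_ne hμ with h | h
    -- Stripping off the two derivatives in `l` leaves a norm that depends only on frozen
    -- parameters. The factor `4` in `freqSum` is slack.
    · refine (P.norm_jet_pairIdx_le _ h).trans ?_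
      rw [P.norm_jet_congr (θ' := φ) μ (fun i hi => by simp [hi.ne']) (hθφ t), ← effFreq_sq]
      simp only [hM, h, h.not_gt, if_true, if_false, add_zero]
      nlinarith [sq_nonneg (P.maxFreq l * P.effFreq φ μ)]
    · rw [P.norm_jet_congr (θ' := φ) μ
        (fun i hi => by simp [hi.ne', (h.trans hi).ne']) (hθφ t)]
      simp only [hM, h, h.not_gt, if_true, if_false, zero_add]
      rw [P.effFreq₂_sq φ h.ne]
  have := abs_integral_sub_le_of_deriv_two
    (u := fun i t => P.lossJet (Function.update (singleIdx l 2) μ i) (Function.update θ' μ t))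
    (φ μ) hr (fun i _ t => P.hasDerivAt_lossJet _ θ' μ i t) hb
  have h0 : Function.update (singleIdx l 2) μ 0 = singleIdx l 2 := by
    conv_rhs => rw [← Function.update_eq_self μ (singleIdx l 2)]
    simp [hμ]
  simpa only [h0] using this

/-- The overlap of the loss with a centred quadratic, up to the fourth derivative. -/
theorem abs_integral_loss_mul_centredSq_sub_le {r B : ℝ} (hr : 0 < r) (l : Fin m)
    (hB : ∀ θ, |P.lossJet (singleIdx l 4) θ| ≤ B) :
    |(∫ θ, P.lossJet 0 θ * centredSq (φ l) r (θ l) ∂cubeUniform φ r)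
      - 2 * r ^ 4 / 45 *
        ∫ θ, P.lossJet (singleIdx l 2) (Function.update θ l (φ l)) ∂cubeUniform φ r|
      ≤ r ^ 6 / 180 * B := by
  have hprob := isProbabilityMeasure_cubeUniform φ hr
  have hc0 := P.continuous_lossJet 0
  have hc : Continuous fun θ : Fin m → ℝ =>
      P.lossJet (singleIdx l 2) (Function.update θ l (φ l)) :=
    (P.continuous_lossJet _).comp (continuous_id.update l continuous_const)
  have hc1 : Continuous fun θ : Fin m → ℝ => P.lossJet 0 θ * centredSq (φ l) r (θ l) := by
    fun_prop
  rw [integral_cubeUniform_resample φ hr hc1 l, ← integral_const_mul, ← integral_sub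
    (integrable_cubeUniform φ hr (continuous_integral_update φ hr hc1 l))
    (integrable_cubeUniform φ hr (hc.const_mul _))]
  have := norm_integral_le_of_norm_le_const (μ := cubeUniform φ r)
    (f := fun θ => (∫ t, P.lossJet 0 (Function.update θ l t) *
      centredSq (φ l) r (Function.update θ l t l) ∂intervalUniform (φ l) r)
      - 2 * r ^ 4 / 45 * P.lossJet (singleIdx l 2) (Function.update θ l (φ l)))
    (C := r ^ 6 / 180 * B) (Filter.Eventually.of_forall fun θ => by
      have := abs_integral_mul_centredSq_sub_le
        (u := fun i t => P.lossJet (Function.update 0 l i) (Function.update θ l t))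
        (φ l) hr (fun i _ t => P.hasDerivAt_lossJet 0 θ l i t) (fun t => hB _)
      have h0 : Function.update (0 : Fin m → ℕ) l 0 = 0 := by simp
      simp only [Function.update_self]
      simpa only [h0, Real.norm_eq_abs] using this)
  simpa using this

/-- From `|b| ≥ s * A - e` follows `b ^ 2 ≥ s ^ 2 * A ^ 2 - 2 * (s * A) * e`, trivially so when `s *
A < e`. As `A ≤ K`, the cross term is controlled by `w ^ 2 * K ^ 2`, hence by `β`. -/
theorem sq_overlap_lower_bound {b I x A K w β r : ℝ} (hr : 0 < r) (hx : 0 ≤ x)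
    (hb : |b - 2 * r ^ 4 / 45 * I| ≤ r ^ 6 / 180 * (w ^ 2 * K)) (hA : A = |I|) (hxA : x ≤ A)
    (hAK : A ≤ K) (hβ : w ^ 2 * K ^ 2 ≤ 4 * β) :
    r ^ 4 / 45 * (x ^ 2 - β * r ^ 2) ≤ b ^ 2 / (4 * r ^ 4 / 45) := by
  have hA0 : 0 ≤ A := hA ▸ abs_nonneg I
  set s : ℝ := 2 * r ^ 4 / 45 with hs
  set e : ℝ := r ^ 6 / 180 * (w ^ 2 * K) with he
  have hs0 : 0 < s := by positivity
  have h1 : s * A - e ≤ |b| := by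
    have h2 : |s * I| = s * A := by rw [abs_mul, abs_of_pos hs0, hA]
    have h3 := abs_sub_abs_le_abs_sub (s * I) b
    rw [abs_sub_comm] at hb
    linarith
  have h2 : s ^ 2 * A ^ 2 - 2 * (s * A) * e ≤ b ^ 2 := by
    rw [← sq_abs b]
    have h4 : 0 ≤ s * A := by positivity
    rcases le_total e (s * A) with h | h
    · nlinarith [abs_nonneg b, sq_nonneg e]
    · nlinarith [sq_nonneg |b|]
  have h5 : A * (w ^ 2 * K) ≤ 4 * β := by
    have : A * (w ^ 2 * K) ≤ K * (w ^ 2 * K) :=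
      mul_le_mul_of_nonneg_right hAK (mul_nonneg (sq_nonneg w) (hA0.trans hAK))
    linarith
  have h6 : x ^ 2 ≤ A ^ 2 := pow_le_pow_left₀ hx hxA 2
  rw [le_div_iff₀ (by positivity)]
  refine le_trans ?_ h2
  have h7 : s ^ 2 * A ^ 2 - 2 * (s * A) * e
      = r ^ 4 / 45 * (4 * r ^ 4 / 45) * (A ^ 2 - A * (w ^ 2 * K) / 4 * r ^ 2) := by
    rw [hs, he]; ring
  rw [h7, mul_right_comm]
  refine mul_le_mul_of_nonneg_left ?_ (by positivity)
  nlinarith [sq_nonneg r]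

/-- The hypothesis makes the lower bound for the averaged curvature nonnegative, so that it can be
squared. One uniform `K` bounds both that average and, times `maxFreq l ^ 2`, the fourth derivative.
-/
theorem variance_lower_bound {r : ℝ} (hr : 0 < r) (Λ : Finset (Fin m))
    (hΛ : ∀ l ∈ Λ, 1 / 6 * P.freqSum φ l * r ^ 2 ≤ P.curv φ l) :
    ∑ l ∈ Λ, r ^ 4 / 45 *
        ((P.curv φ l - 1 / 6 * P.freqSum φ l * r ^ 2) ^ 2 - P.beta φ l * r ^ 2)
      ≤ P.lossVar φ r := by
  have hprob := isProbabilityMeasure_cubeUniform φ hr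
  have := sum_sq_integral_mul_centredSq_le_variance φ hr (P.continuous_lossJet 0) Λ
  rw [lossVar, ← funext P.lossJet_zero]
  refine le_trans (Finset.sum_le_sum fun l hl => ?_) this
  obtain ⟨K, hK, hβ⟩ := P.exists_norm_jet_le φ l
  have hB : ∀ θ, |P.lossJet (singleIdx l 4) θ| ≤ P.maxFreq l ^ 2 * K := fun θ =>
    (P.abs_lossJet_le _ θ).trans ((P.norm_jet_singleIdx_four_le θ l).trans
      (mul_le_mul_of_nonneg_left (hK θ) (sq_nonneg _)))
  refine sq_overlap_lower_bound hr (sub_nonneg.2 (hΛ l hl))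
    (P.abs_integral_loss_mul_centredSq_sub_le φ hr l hB) rfl ?_ ?_ hβ
  · have h1 := P.abs_integral_lossJet_sub_le φ hr l
    rw [abs_sub_comm] at h1
    rw [curv_eq]
    have h2 := abs_sub_abs_le_abs_sub (P.lossJet (singleIdx l 2) φ)
      (∫ θ, P.lossJet (singleIdx l 2) (Function.update θ l (φ l)) ∂cubeUniform φ r)
    linarith
  · have := norm_integral_le_of_norm_le_const (μ := cubeUniform φ r)
      (f := fun θ => P.lossJet (singleIdx l 2) (Function.update θ l (φ l))) (C := K)
      (Filter.Eventually.of_forall fun θ => (P.abs_lossJet_le _ _).trans (hK _))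
    simpa using this

theorem curv_nonneg (l : Fin m) : 0 ≤ P.curv φ l := abs_nonneg _

/-- A vanishing numerator or denominator makes the quotient `0`, which `0 < r` excludes. -/
theorem mul_le_of_sq_le_rPatchSqAt {r : ℝ} (hr : 0 < r) {l : Fin m}
    (h : r ^ 2 ≤ P.rPatchSqAt φ l) :
    0 < P.curv φ l ∧ r ^ 2 * (8 * P.curv φ l * P.freqSum φ l + 24 * P.beta φ l)
      ≤ 9 * P.curv φ l ^ 2 := by
  have hr2 : 0 < r ^ 2 := by positivity
  have hc := P.curv_nonneg φ l
  have hF := P.freqSum_nonneg φ l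
  have hβ := P.beta_nonneg φ l
  have hD : 0 ≤ 8 * P.curv φ l * P.freqSum φ l + 24 * P.beta φ l := by positivity
  unfold rPatchSqAt at h
  refine ⟨hc.lt_of_ne' fun h0 => ?_, ?_⟩
  · rw [h0] at h
    norm_num at h
    linarith
  · rcases hD.eq_or_lt with h0 | h0
    · rw [← h0, div_zero] at h
      linarith
    · exact (le_div_iff₀ h0).1 h

theorem variance_bounds {r : ℝ} (hr : 0 < r) (Λ : Finset (Fin m)) (hΛ : Λ.Nonempty)
    (h : r ^ 2 ≤ P.rPatchSq φ Λ hΛ) :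
    (∑ l ∈ Λ, r ^ 4 / 45 *
        ((P.curv φ l - 1 / 6 * P.freqSum φ l * r ^ 2) ^ 2 - P.beta φ l * r ^ 2)
      ≤ P.lossVar φ r) ∧
    1 / 72 * (∑ l ∈ Λ, P.curv φ l ^ 2) * r ^ 4 ≤ P.lossVar φ r := by
  have hl : ∀ l ∈ Λ, 0 < P.curv φ l ∧
      r ^ 2 * (8 * P.curv φ l * P.freqSum φ l + 24 * P.beta φ l) ≤ 9 * P.curv φ l ^ 2 :=
    fun l hl => P.mul_le_of_sq_le_rPatchSqAt φ hr (h.trans (Finset.inf'_le _ hl))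
  have hr2 : 0 < r ^ 2 := by positivity
  have h1 := P.variance_lower_bound φ hr Λ fun l hlΛ => by
    obtain ⟨hc, hD⟩ := hl l hlΛ
    have hβ := mul_nonneg hr2.le (P.beta_nonneg φ l)
    have hF := P.freqSum_nonneg φ l
    have h2 : P.curv φ l * (8 * (P.freqSum φ l * r ^ 2)) ≤ P.curv φ l * (9 * P.curv φ l) := by
      nlinarith
    have h3 := le_of_mul_le_mul_left h2 hc
    linarith
  refine ⟨h1, le_trans ?_ h1⟩
  rw [Finset.mul_sum, Finset.sum_mul]
  refine Finset.sum_le_sum fun l hlΛ => ?_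
  obtain ⟨hc, hD⟩ := hl l hlΛ
  -- Expanding the square, the loss is at most one 24th of the left side of `hD`, that is `3 / 8` of
  -- the squared curvature.
  have h4 : 5 / 8 * P.curv φ l ^ 2
      ≤ (P.curv φ l - 1 / 6 * P.freqSum φ l * r ^ 2) ^ 2 - P.beta φ l * r ^ 2 := by
    nlinarith [sq_nonneg (1 / 6 * P.freqSum φ l * r ^ 2)]
  have h5 := mul_le_mul_of_nonneg_left h4 (show 0 ≤ r ^ 4 / 45 by positivity)
  linarith

/-! ### Polynomial bounds and the asymptotic guarantee -/

theorem effFreq_sq_le (μ : Fin m) : P.effFreq φ μ ^ 2 ≤ P.maxFreq μ ^ 2 * ‖P.obs‖ := by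
  rw [effFreq_sq]
  exact P.norm_jet_singleIdx_two_le φ μ

theorem effFreq₂_sq_le {l μ : Fin m} (h : l < μ) :
    P.effFreq₂ φ l μ ^ 2 ≤ P.maxFreq μ ^ 2 * (P.maxFreq l ^ 2 * ‖P.obs‖) := by
  rw [P.effFreq₂_sq φ h.ne, pairIdx, Function.update_comm h.ne]
  exact (P.norm_jet_pairIdx_le φ h).trans
    (mul_le_mul_of_nonneg_left (P.norm_jet_singleIdx_two_le φ l) (sq_nonneg _))

/-- Each of the `m - 1` labels other than `l` contributes at most `4 * w ^ 4 * o`. -/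
theorem freqSum_le {w o : ℝ} (hw : ∀ l, P.maxFreq l ≤ w) (ho : ‖P.obs‖ ≤ o) (l : Fin m) :
    P.freqSum φ l ≤ 4 * m * w ^ 4 * o := by
  have ho0 : 0 ≤ o := (norm_nonneg _).trans ho
  have hw2 : ∀ l, P.maxFreq l ^ 2 ≤ w ^ 2 := fun l =>
    pow_le_pow_left₀ (P.maxFreq_nonneg l) (hw l) 2
  have h1 : ∑ μ ∈ Finset.Iio l, P.effFreq φ μ ^ 2 ≤ ((Finset.Iio l).card : ℝ) * (w ^ 2 * o) := by
    rw [← nsmul_eq_mul]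
    exact Finset.sum_le_card_nsmul _ _ _ fun μ _ => (P.effFreq_sq_le φ μ).trans
      (mul_le_mul (hw2 μ) ho (norm_nonneg _) (sq_nonneg _))
  have h2 : ∑ μ ∈ Finset.Ioi l, P.effFreq₂ φ l μ ^ 2
      ≤ ((Finset.Ioi l).card : ℝ) * (w ^ 2 * (w ^ 2 * o)) := by
    rw [← nsmul_eq_mul]
    exact Finset.sum_le_card_nsmul _ _ _ fun μ hμ =>
      (P.effFreq₂_sq_le φ (Finset.mem_Ioi.1 hμ)).trans
        (mul_le_mul (hw2 μ) (mul_le_mul (hw2 l) ho (norm_nonneg _) (sq_nonneg _))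
          (by positivity) (sq_nonneg _))
  have h3 : ((Finset.Iio l).card : ℝ) + (Finset.Ioi l).card ≤ m := by
    rw [Fin.card_Iio, Fin.card_Ioi]
    have := l.2
    exact_mod_cast (by omega : (l : ℕ) + (m - 1 - l) ≤ m)
  have h4 : 4 * P.maxFreq l ^ 2 * ∑ μ ∈ Finset.Iio l, P.effFreq φ μ ^ 2
      ≤ 4 * w ^ 2 * (((Finset.Iio l).card : ℝ) * (w ^ 2 * o)) :=
    mul_le_mul (by linarith [hw2 l]) h1 (by positivity) (by positivity)
  unfold freqSum
  have h5 : 0 ≤ w ^ 4 * o := by positivity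
  have h6 : (0 : ℝ) ≤ (Finset.Ioi l).card := by positivity
  nlinarith [mul_le_mul_of_nonneg_right h3 h5, mul_nonneg h6 h5]

theorem beta_le {w o : ℝ} (hw : ∀ l, P.maxFreq l ≤ w) (ho : ‖P.obs‖ ≤ o) (l : Fin m) :
    P.beta φ l ≤ 32 / 3 * w ^ 6 * o ^ 2 := by
  have hω := P.maxFreq_nonneg l
  have h1 : P.maxFreq l ^ 6 * ‖P.obs‖ ^ 2 ≤ w ^ 6 * o ^ 2 := by
    have h2 := hw l
    have h3 := norm_nonneg P.obs
    gcongr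
  have h0 : 0 ≤ P.maxFreq l ^ 6 * ‖P.obs‖ ^ 2 := by positivity
  unfold beta
  split_ifs
  · have h2 : P.effFreq φ l ^ 4 ≤ (P.maxFreq l ^ 2 * ‖P.obs‖) ^ 2 := by
      rw [show P.effFreq φ l ^ 4 = (P.effFreq φ l ^ 2) ^ 2 by ring]
      exact pow_le_pow_left₀ (sq_nonneg _) (P.effFreq_sq_le φ l) 2
    have h3 := mul_le_mul_of_nonneg_left h2 (sq_nonneg (P.maxFreq l))
    nlinarith
  · linarith

/-- Keeps the denominator of the patch radius positive: a nonzero curvature forces both `maxFreq l`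
and the bound `K` to be nonzero. -/
theorem beta_pos {l : Fin m} (hc : 0 < P.curv φ l) : 0 < P.beta φ l := by
  obtain ⟨K, hK, hβ⟩ := P.exists_norm_jet_le φ l
  have h1 : P.curv φ l ≤ K := by
    rw [curv_eq]; exact (P.abs_lossJet_le _ φ).trans (hK φ)
  have h2 : P.maxFreq l ≠ 0 := fun h0 => by
    have := P.curv_le φ l
    rw [h0] at this
    norm_num at this
    linarith
  have h3 : 0 < P.maxFreq l ^ 2 * K ^ 2 := by
    have : 0 < K := hc.trans_le h1
    positivity
  linarith

/-- A sufficient condition for lying within the patch radius of a single parameter. -/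
theorem sq_le_rPatchSqAt {w o r : ℝ} (hw : ∀ l, P.maxFreq l ≤ w) (ho : ‖P.obs‖ ≤ o) {l : Fin m}
    (hc : 0 < P.curv φ l) (hr : r ^ 2 * (288 * m * w ^ 6 * o ^ 2) ≤ 9 * P.curv φ l ^ 2) :
    r ^ 2 ≤ P.rPatchSqAt φ l := by
  have hF := P.freqSum_nonneg φ l
  have hβ := P.beta_pos φ hc
  have ho0 : 0 ≤ o := (norm_nonneg _).trans ho
  have hcle : P.curv φ l ≤ w ^ 2 * o := (P.curv_le φ l).trans
    (mul_le_mul (pow_le_pow_left₀ (P.maxFreq_nonneg l) (hw l) 2) ho (norm_nonneg _) (sq_nonneg _))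
  have h1 := mul_le_mul hcle (P.freqSum_le φ hw ho l) hF (by positivity)
  have h2 := P.beta_le φ hw ho l
  have hm : (1 : ℝ) ≤ m := by exact_mod_cast (Nat.zero_le _).trans_lt l.2
  have h3 : 0 ≤ w ^ 6 * o ^ 2 := by positivity
  have h4 := mul_le_mul_of_nonneg_right hm h3
  unfold rPatchSqAt
  -- The `freqSum` term is at most `32 * m * w ^ 6 * o ^ 2` and the `beta` term at most `256 * w ^ 6
  -- * o ^ 2`; with `1 ≤ m` this makes `288`.
  rw [le_div_iff₀ (by positivity)]
  refine le_trans (mul_le_mul_of_nonneg_left ?_ (sq_nonneg r)) hr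
  nlinarith

theorem maxFreq_le (l : Fin m) : P.maxFreq l ≤ 2 * ‖P.gen l‖ := maxFreqOf_le _

/-- The quantitative form of the asymptotic guarantee for one problem of size `x`. -/
theorem one_le_mul_lossVar {x p r C₁ C₂ C₃ C₄ C₅ C₆ C₇ : ℝ} {a b c k₁ : ℕ} {l : Fin m}
    (hx : 1 ≤ x) (hr : 0 < r) (hC₃ : 0 < C₃) (hC₆ : 0 < C₆)
    (hO : ‖P.obs‖ ≤ C₁ * x ^ a) (hH : ∀ j, ‖P.gen j‖ ≤ C₂ * x ^ b)
    (hcurv : 1 ≤ C₃ * P.curv φ l * x ^ c) (hp : x ^ (3 * b + a + c + 1) ≤ C₄ * p)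
    (hr_le : r * (p * √m) ≤ C₅) (hr_ge : 1 ≤ C₆ * r * (p * √m))
    (hp_le : p ≤ C₇ * x ^ k₁)
    (hlarge : C₃ ^ 2 * (18432 * C₂ ^ 6 * C₁ ^ 2 * (C₄ * C₅) ^ 2) ≤ 9 * x) :
    1 ≤ 72 * (C₃ ^ 2 * C₆ ^ 4 * C₇ ^ 4) * P.lossVar φ r * (x ^ (2 * c + 4 * k₁) * (m : ℝ) ^ 2) := by
  have hx0 : 0 < x := by linarith
  have hc0 := P.curv_nonneg φ l
  have hc : 0 < P.curv φ l := hc0.lt_of_ne' fun h => by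
    rw [h] at hcurv
    norm_num at hcurv
  have hpm : 0 < p * √m := by
    by_contra h
    nlinarith [mul_pos hC₆ hr, not_lt.1 h]
  have hsm : 0 ≤ √(m : ℝ) := Real.sqrt_nonneg _
  have hp0 : 0 < p := pos_of_mul_pos_left hpm hsm
  have hsq : √(m : ℝ) ^ 2 = m := Real.sq_sqrt (Nat.cast_nonneg m)
  have hO0 : 0 ≤ C₁ * x ^ a := (norm_nonneg _).trans hO
  have hw : ∀ j, P.maxFreq j ≤ 2 * (C₂ * x ^ b) := fun j =>
    (P.maxFreq_le j).trans (by linarith [hH j])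
  have hC₄ : 0 ≤ C₄ := by
    by_contra h
    have : 0 < x ^ (3 * b + a + c + 1) := by positivity
    nlinarith [not_le.1 h]
  have hmul : r * √m * x ^ (3 * b + a + c + 1) ≤ C₄ * C₅ := by
    calc r * √m * x ^ (3 * b + a + c + 1) ≤ r * √m * (C₄ * p) :=
          mul_le_mul_of_nonneg_left hp (by positivity)
      _ = C₄ * (r * (p * √m)) := by ring
      _ ≤ C₄ * C₅ := mul_le_mul_of_nonneg_left hr_le hC₄
  have hcurv2 : 1 ≤ (C₃ * P.curv φ l * x ^ c) ^ 2 := one_le_pow₀ hcurv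
  -- The left side of the criterion in `sq_le_rPatchSqAt`, with `maxFreq` at most twice the norm of
  -- the generator; `288 * 2 ^ 6 = 18432`.
  set X : ℝ := r ^ 2 * (288 * m * (2 * (C₂ * x ^ b)) ^ 6 * (C₁ * x ^ a) ^ 2) with hX
  have hX0 : 0 ≤ X := by positivity
  have hpatch : X ≤ 9 * P.curv φ l ^ 2 := by
    have h1 : X * x ^ (2 * c) * x ^ 2
        = 18432 * C₂ ^ 6 * C₁ ^ 2 * (r * √m * x ^ (3 * b + a + c + 1)) ^ 2 := by
      rw [hX]
      generalize √(m : ℝ) = y at hsq ⊢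
      rw [← hsq]
      ring
    have h2 : (r * √m * x ^ (3 * b + a + c + 1)) ^ 2 ≤ (C₄ * C₅) ^ 2 :=
      pow_le_pow_left₀ (by positivity) hmul 2
    -- The `+ 1` in the exponent supplies the factor `x ^ 2`, which beats the constants through
    -- `hlarge`.
    have h3 : C₃ ^ 2 * (X * x ^ (2 * c)) * x ^ 2 ≤ 9 * x ^ 2 := by
      calc C₃ ^ 2 * (X * x ^ (2 * c)) * x ^ 2
          = C₃ ^ 2 * (18432 * C₂ ^ 6 * C₁ ^ 2 * (r * √m * x ^ (3 * b + a + c + 1)) ^ 2) := by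
            rw [← h1]; ring
        _ ≤ C₃ ^ 2 * (18432 * C₂ ^ 6 * C₁ ^ 2 * (C₄ * C₅) ^ 2) := by gcongr
        _ ≤ 9 * x := hlarge
        _ ≤ 9 * x ^ 2 := by nlinarith
    have h4 := le_of_mul_le_mul_right h3 (by positivity)
    calc X ≤ X * (C₃ * P.curv φ l * x ^ c) ^ 2 := le_mul_of_one_le_right hX0 hcurv2
      _ = P.curv φ l ^ 2 * (C₃ ^ 2 * (X * x ^ (2 * c))) := by ring
      _ ≤ P.curv φ l ^ 2 * 9 := mul_le_mul_of_nonneg_left h4 (sq_nonneg _)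
      _ = 9 * P.curv φ l ^ 2 := by ring
  have hvar := (P.variance_bounds φ hr {l} (Finset.singleton_nonempty l)
    (by simpa [rPatchSq] using P.sq_le_rPatchSqAt φ hw hO hc hpatch)).2
  rw [Finset.sum_singleton] at hvar
  have h5 : 1 ≤ C₆ * r * (C₇ * x ^ k₁ * √m) := hr_ge.trans
    (mul_le_mul_of_nonneg_left (mul_le_mul_of_nonneg_right hp_le hsm) (by positivity))
  calc (1 : ℝ) ≤ (C₃ * P.curv φ l * x ^ c) ^ 2 * (C₆ * r * (C₇ * x ^ k₁ * √m)) ^ 4 :=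
        one_le_mul_of_one_le_of_one_le hcurv2 (one_le_pow₀ h5)
    _ = 72 * (C₃ ^ 2 * C₆ ^ 4 * C₇ ^ 4) * (1 / 72 * P.curv φ l ^ 2 * r ^ 4)
        * (x ^ (2 * c + 4 * k₁) * (m : ℝ) ^ 2) := by
      generalize √(m : ℝ) = y at hsq ⊢
      rw [← hsq]
      ring
    _ ≤ _ := by gcongr

end VarProblem

/-- The exponent `3 * b + a + c + 1` puts `r` inside the patch. Then $c_q^2r^4$ is at least of order
$n^{-2c}(|p|\sqrt m)^{-4}$, and $|p|\in\mathcal O(n^{k_1})$ gives the exponent `2 * c + 4 * k₁`. -/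
theorem lossVar_asymptotic (a b c k₁ : ℕ) (m : ℕ → ℕ) (P : ∀ n, VarProblem n (m n))
    (φ : ∀ n, Fin (m n) → ℝ) (q : ∀ n, Fin (m n))
    (hO : (fun n => ‖(P n).obs‖) =O[atTop] fun n : ℕ => (n : ℝ) ^ a)
    (hH : ∃ C : ℝ, ∀ᶠ n : ℕ in atTop, ∀ j, ‖(P n).gen j‖ ≤ C * (n : ℝ) ^ b)
    (hc : (fun n : ℕ => 1 / (n : ℝ) ^ c) =O[atTop] fun n => (P n).curv (φ n) (q n))
    (p r : ℕ → ℝ) (hp : (fun n : ℕ => (n : ℝ) ^ (3 * b + a + c + 1)) =O[atTop] p)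
    (hp' : p =O[atTop] fun n : ℕ => (n : ℝ) ^ k₁) (hr : ∀ n, 0 < r n)
    (hΘ : r =Θ[atTop] fun n => 1 / (p n * Real.sqrt (m n))) :
    (fun n : ℕ => 1 / ((n : ℝ) ^ (2 * c + 4 * k₁) * (m n : ℝ) ^ 2))
      =O[atTop] fun n => (P n).lossVar (φ n) (r n) := by
  obtain ⟨C₁, -, h₁⟩ := hO.exists_pos
  obtain ⟨C₂, h₂⟩ := hH
  obtain ⟨C₃, hC₃, h₃⟩ := hc.exists_pos
  obtain ⟨C₄, hC₄, h₄⟩ := hp.exists_pos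
  obtain ⟨C₅, -, h₅⟩ := hΘ.1.exists_pos
  obtain ⟨C₆, hC₆, h₆⟩ := hΘ.2.exists_pos
  obtain ⟨C₇, -, h₇⟩ := hp'.exists_pos
  refine IsBigO.of_bound (72 * (C₃ ^ 2 * C₆ ^ 4 * C₇ ^ 4)) ?_
  have hlarge := tendsto_natCast_atTop_atTop (R := ℝ) |>.eventually_ge_atTop
    (C₃ ^ 2 * (18432 * C₂ ^ 6 * C₁ ^ 2 * (C₄ * C₅) ^ 2) / 9)
  filter_upwards [h₁.bound, h₂, h₃.bound, h₄.bound, h₅.bound, h₆.bound, h₇.bound, hlarge,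
    eventually_ge_atTop 1] with n e₁ e₂ e₃ e₄ e₅ e₆ e₇ e₈ hn
  have hx : (1 : ℝ) ≤ n := by exact_mod_cast hn
  have hx0 : (0 : ℝ) < n := by linarith
  have hm : (0 : ℝ) < m n := by exact_mod_cast (Nat.zero_le _).trans_lt (q n).2
  have hsm : 0 < √(m n : ℝ) := Real.sqrt_pos.2 hm
  simp only [abs_norm, norm_div, norm_mul, norm_pow, norm_one, Real.norm_eq_abs, Nat.abs_cast,
    abs_of_pos (hr n), abs_of_pos hsm, abs_of_nonneg ((P n).curv_nonneg _ _)]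
    at e₁ e₃ e₄ e₅ e₆ e₇
  -- The sign of `p` is free, so the quantitative bound is applied to `|p n|`.
  have hp0 : 0 < |p n| := by
    by_contra h
    have : (0 : ℝ) < (n : ℝ) ^ (3 * b + a + c + 1) := by positivity
    nlinarith [not_lt.1 h]
  have hpm : 0 < |p n| * √(m n : ℝ) := by positivity
  have key := (P n).one_le_mul_lossVar (φ n) (p := |p n|) (C₁ := C₁) (C₂ := C₂) (C₃ := C₃)
    (C₄ := C₄) (C₅ := C₅) (C₆ := C₆) (C₇ := C₇) (a := a) (b := b) (c := c) (k₁ := k₁) (l := q n)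
    hx (hr n) hC₃ hC₆ e₁ e₂
    (by rwa [div_le_iff₀ (by positivity)] at e₃) e₄
    (by rwa [mul_one_div, le_div_iff₀ hpm] at e₅)
    (by rwa [div_le_iff₀ hpm] at e₆) e₇ (by linarith)
  have hv : 0 ≤ (P n).lossVar (φ n) (r n) := variance_nonneg _ _
  rw [Real.norm_of_nonneg (by positivity), Real.norm_of_nonneg hv, div_le_iff₀ (by positivity)]
  exact key

theorem theorem1 :
    -- explicit bounds
    (∀ (n m : ℕ) (P : VarProblem n m) (φ : Fin m → ℝ) (Λ : Finset (Fin m)) (hΛ : Λ.Nonempty),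
      (∀ r : ℝ, 0 < r → r ^ 2 ≤ P.rPatchSq φ Λ hΛ →
        (∑ l ∈ Λ, r ^ 4 / 45 *
            ((P.curv φ l - 1 / 6 * P.freqSum φ l * r ^ 2) ^ 2 - P.beta φ l * r ^ 2)
          ≤ P.lossVar φ r) ∧
        1 / 72 * (∑ l ∈ Λ, P.curv φ l ^ 2) * r ^ 4 ≤ P.lossVar φ r) ∧
      (0 < P.rPatch φ Λ hΛ →
        1 / 72 * (∑ l ∈ Λ, P.curv φ l ^ 2) * P.rPatch φ Λ hΛ ^ 4
          ≤ P.lossVar φ (P.rPatch φ Λ hΛ))) ∧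
    -- asymptotic guarantee
    (∀ a b c : ℕ, ∃ k₀ : ℕ, ∀ k₁ : ℕ, ∃ k₂ : ℕ,
      ∀ (m : ℕ → ℕ) (P : ∀ n, VarProblem n (m n)) (φ : ∀ n, Fin (m n) → ℝ) (q : ∀ n, Fin (m n)),
        ((fun n => ‖(P n).obs‖) =O[atTop] fun n : ℕ => (n : ℝ) ^ a) →
        (∃ C : ℝ, ∀ᶠ n : ℕ in atTop, ∀ j, ‖(P n).gen j‖ ≤ C * (n : ℝ) ^ b) →
        ((fun n : ℕ => 1 / (n : ℝ) ^ c) =O[atTop] fun n => (P n).curv (φ n) (q n)) →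
        ∀ (p r : ℕ → ℝ),
          ((fun n : ℕ => (n : ℝ) ^ k₀) =O[atTop] p) →
          (p =O[atTop] fun n : ℕ => (n : ℝ) ^ k₁) →
          (∀ n, 0 < r n) →
          (r =Θ[atTop] fun n => 1 / (p n * Real.sqrt (m n))) →
          ((fun n : ℕ => 1 / ((n : ℝ) ^ k₂ * (m n : ℝ) ^ 2))
            =O[atTop] fun n => (P n).lossVar (φ n) (r n))) := by

  refine ⟨fun n m P φ Λ hΛ => ⟨fun r hr h => P.variance_bounds φ hr Λ hΛ h, fun h => ?_⟩,
    fun a b c => ⟨3 * b + a + c + 1, fun k₁ => ⟨2 * c + 4 * k₁,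
      fun m P φ q hO hH hc p r hp hp' hr hΘ =>
        lossVar_asymptotic a b c k₁ m P φ q hO hH hc p r hp hp' hr hΘ⟩⟩⟩
  refine (P.variance_bounds φ h Λ hΛ ?_).2
  rw [VarProblem.rPatch, Real.sq_sqrt (Real.sqrt_pos.1 h).le]
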